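/- **Setting.** Let $p$ be a prime and $\omega\in\mathbb{C}$ a primitive $p$-th root of unity. Let $X_p|i\rangle=|i+1 \bmod p\rangle$, $Z_\omega|i\rangle=\omega^i|i\rangle$ on $\mathbb{C}^p$, and for a finite set $N$ of qudits let $E_N$ be the group of the operators $\omega^i M(\vec a|\vec b)$, $M(\vec a|\vec b)=\bigotimes_{j\in N}X_p^{a_j}Z_\omega^{b_j}$, $\vec a,\vec b\in\mathbb{F}_p^N$; $E_n=E_{\{1,\dots,n\}}$. A stabilizer is a commutative subgroup $S$ of $E_n$; a stabilizer code $Q(S)$ is a nonzero simultaneous eigenspace of all elements of $S$, and it is an $[[n,k,d]]_p$ code if $\dim Q(S)=p^k$ and $d=d(S)$ is the minimum weight $\#\{j\mid (a_j,b_j)\ne 0\}$ of the elements $\omega^iM(\vec a|\vec b)\in E_n$ that commute with all of $S$ but do not lie in the group generated by $S$ and $\omega I$ ($d=\infty$ if there are none). A check matrix of $S$ is a matrix $H_S=[H_X|H_Z]$ over $\mathbb{F}_p$ with $2n$ columns whose row space is $f(S)=\{(\vec a|\vec b)\mid \omega^iM(\vec a|\vec b)\in S\text{ for some }i\}$. For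 $J\subset\{1,\dots,n\}$, *conditions 1 and 2* say that there are $2|J|$ pairwise different rows $r_j,s_j$ ($j\in J$) of $H_S$ such that the $j$th column of $H_S$ has a $1$ in row $r_j$ and $0$ elsewhere, and the $(n+j)$th column has a $1$ in row $s_j$ and $0$ elsewhere, for every $j\in J$. Let $c=|J|$, $\overline J=\{1,\dots,n\}\setminus J$, and let $E_{n-|J|}=E_{\overline J}$ be the error group of the qudits in $\overline J$ (the sender's), the qudits in $J$ being the receiver's halves of $c$ maximally entangled pairs. Let $G$ be a subgroup of $E_{n-|J|}$, $G'$ a stabilizer of $E_n$ and $U$ a unitary matrix on the qudits in $\overline J$. Then $(G,G',U)$ is an $[[n-|J|,k,d;|J|]]_p$ EAQECC if $G$ is non-abelian and, with $\ell=(n-|J|)-c-k\ge 0$ and after a labelling of the sender's qudits as $c$ halves of pairs (labelled by $J$), $\ell$ ancillas and $k$ information qudits, the following hold. * $G$ is generated by elements $\overline X_i$, $\overline Z_i$ ($i\in J$) and $\overline Z_a$ ($a$ an ancilla) that commute pairwise, except that $\overline X_i\overline Z_i=\omega^{-\mu_i}\overline Z_i\overline X_i\neq\overline Z_i\overline X_i$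 with integers $\mu_i$. * Up to phases, $\overline X_i$ and $\overline Z_j$ are $U X_{(i)}U^\dagger$ and $U Z_{(j)}U^\dagger$, where $X_{(i)}$ is $X_p^{\mu_i}$ on the sender's half of pair $i$ and $Z_{(j)}$ is $Z_\omega$ on qudit $j$ (a half of a pair or an ancilla). * The operators $\overline X_i\otimes X_p^{\mu_i}$, $\overline Z_i\otimes Z_\omega^{-1}$ ($i\in J$, second factor on receiver's qudit $i$) and $\overline Z_a\otimes I$ belong to $G'$, and together with the scalars in $G'$ they generate $G'$. * The encoded states $(U\otimes I)|\Psi\rangle$, $|\Psi\rangle=p^{-c/2}\sum_{i\in\mathbb{F}_p^c}|i\rangle|0\rangle^{\otimes\ell}|\psi\rangle|i\rangle$ with $|\psi\rangle\in(\mathbb{C}^p)^{\otimes k}$ (last factor the receiver's), form a stabilizer code $Q(G')$. * $d=d(G')$. **Lemma.** Let $S$ be a stabilizer of $E_n$ with an $[[n,k,d]]_p$ stabilizer code $Q(S)$, let $J\subset\{1,\dots,n\}$ be non-empty, and suppose that $J$ and some check matrix $H_S$ of $S$ satisfy conditions 1 and 2. Then there are a non-abelian subgroup $S^J$ of $E_{n-|J|}$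 and a unitary matrix $U_J$ such that $(S^J,S,U_J)$ is an $[[n-|J|,k,d;|J|]]_p$ EAQECC, and, for a suitable such labelling: 1. its encoded states are exactly the vectors of $Q(S)$; 2. its erasure-correcting ability, counting the receiver's entangled halves, equals that of $Q(S)$: for every $T\subset\{1,\dots,n\}$, some quantum channel from the qudits outside $T$ restores every $|\psi\rangle\in(\mathbb{C}^p)^{\otimes k}$ from its encoding if and only if some quantum channel from the qudits outside $T$ restores every state of $Q(S)$; 3. in the quantum secret sharing scheme that distributes the $n$ qudits of the encoding of a secret $|\psi\rangle$ as shares, the shares in $J$ can be distributed in advance: a state of the shares in $J$ and a memory of the dealer, independent of $|\psi\rangle$, is prepared first, and the remaining shares are then produced from the memory and $|\psi\rangle$ by an isometry that does not act on $J$. -/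

import Mathlib

open scoped Matrix

namespace QSS

section Paulis

variable {p : ℕ} [Fact p.Prime] {N : Type} [Fintype N] [DecidableEq N]

/-- Computational-basis labels of a register of qudits indexed by `N`: the state space is
`Basis p N → ℂ`, that is `(ℂ^p)^{⊗ N}`. -/
abbrev Basis (p : ℕ) (N : Type) : Type := N → ZMod p

/-- Operators on the register of qudits indexed by `N`. -/
abbrev Op (p : ℕ) (N : Type) : Type := Matrix (Basis p N) (Basis p N) ℂ

/-- The unitary group of the register of qudits indexed by `N`. -/
abbrev UnitaryOp (p : ℕ) [Fact p.Prime] (N : Type) [Fintype N] [DecidableEq N] : Type :=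
  Matrix.unitaryGroup (Basis p N) ℂ

/-- The shift `X_p |i⟩ = |i + 1 mod p⟩`. -/
def shift (p : ℕ) : Matrix (ZMod p) (ZMod p) ℂ :=
  Matrix.of fun x y => if x = y + 1 then 1 else 0

/-- The clock `Z_ω |i⟩ = ω ^ i |i⟩`. -/
noncomputable def clock (p : ℕ) (ω : ℂ) : Matrix (ZMod p) (ZMod p) ℂ :=
  Matrix.diagonal fun y => ω ^ y.val

/-- The tensor product `⨂ j, A j` of one-qudit operators. -/
noncomputable def tensor (A : N → Matrix (ZMod p) (ZMod p) ℂ) : Op p N :=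
  Matrix.of fun x y => ∏ j, A j (x j) (y j)

/-- The operator acting as `A` on qudit `j` and as the identity on all others. -/
noncomputable def single (j : N) (A : Matrix (ZMod p) (ZMod p) ℂ) : Op p N :=
  tensor (Function.update (fun _ => 1) j A)

/-- `M(a|b) = X_p^{a_1} Z_ω^{b_1} ⊗ ⋯ ⊗ X_p^{a_n} Z_ω^{b_n}`. -/
noncomputable def pauli (ω : ℂ) (a b : N → ZMod p) : Op p N :=
  tensor fun j => shift p ^ (a j).val * clock p ω ^ (b j).val

/-- The error group `E_n`, as a set of unitary matrices. -/
def errorGroup (ω : ℂ) (N : Type) [Fintype N] [DecidableEq N] : Set (UnitaryOp p N) :=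
  {M | ∃ (i : ℕ) (a b : N → ZMod p), (M : Op p N) = ω ^ i • pauli ω a b}

/-- A stabilizer: a commutative subgroup of `E_n`. -/
def IsStabilizer (ω : ℂ) (S : Subgroup (UnitaryOp p N)) : Prop :=
  (S : Set (UnitaryOp p N)) ⊆ errorGroup ω N ∧ ∀ A ∈ S, ∀ B ∈ S, A * B = B * A

/-- `Q` is a stabilizer code `Q(S)`: a (nonzero) simultaneous eigenspace of all elements of `S`. -/
def IsStabilizerCode (S : Subgroup (UnitaryOp p N)) (Q : Submodule ℂ (Basis p N → ℂ)) : Prop :=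
  Q ≠ ⊥ ∧ ∃ ev : UnitaryOp p N → ℂ,
    ∀ v, v ∈ Q ↔ ∀ M ∈ S, (M : Op p N) *ᵥ v = ev M • v

/-- `f(S)`: the vectors `(a|b)` such that some `ω ^ i M(a|b)` belongs to `S`. -/
def symplecticImage (ω : ℂ) (S : Subgroup (UnitaryOp p N)) : Set (N ⊕ N → ZMod p) :=
  {v | ∃ M ∈ S, ∃ i : ℕ,
    (M : Op p N) = ω ^ i • pauli ω (fun j => v (Sum.inl j)) (fun j => v (Sum.inr j))}

/-- `H = [H_X | H_Z]` is a check matrix of `S`: its row space is `f(S)`. -/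
def IsCheckMatrix {R : Type} (ω : ℂ) (S : Subgroup (UnitaryOp p N))
    (H : Matrix R (N ⊕ N) (ZMod p)) : Prop :=
  (Submodule.span (ZMod p) (Set.range fun i => H i) : Set (N ⊕ N → ZMod p)) = symplecticImage ω S

/-- The conditions on `J` and a check matrix: the columns `j` and `n + j` with `j ∈ J` are
standard unit vectors, the `2 |J|` rows containing the ones being pairwise different. -/
def SatisfiesConditions {R : Type} [DecidableEq R] (H : Matrix R (N ⊕ N) (ZMod p))
    (J : Finset N) : Prop :=
  ∃ r s : {j // j ∈ J} → R, Function.Injective (Sum.elim r s) ∧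
    (∀ j i, H i (Sum.inl j.1) = if i = r j then 1 else 0) ∧
    (∀ j i, H i (Sum.inr j.1) = if i = s j then 1 else 0)

/-- The weight of `ω ^ i M(a|b)`. -/
def weight (a b : N → ZMod p) : ℕ :=
  (Finset.univ.filter fun j => (a j, b j) ≠ 0).card

/-- The subgroup generated by `ω I` and `S`. -/
def withPhases (ω : ℂ) (S : Subgroup (UnitaryOp p N)) : Subgroup (UnitaryOp p N) :=
  Subgroup.closure ({M | M ∈ S} ∪ {M | (M : Op p N) = ω • (1 : Op p N)})

/-- The minimum distance `d(S) = min {w(M) | M ∈ S' \ S̄}`, where `S'` is the set of the elements of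
`E_n` that commute with all of `S`; it is `⊤` exactly if `S' \ S̄` is empty. -/
noncomputable def minDistance (ω : ℂ) (S : Subgroup (UnitaryOp p N)) : ℕ∞ :=
  sInf {w | ∃ (M : UnitaryOp p N) (i : ℕ) (a b : N → ZMod p),
    (M : Op p N) = ω ^ i • pauli ω a b ∧ (∀ L ∈ S, M * L = L * M) ∧ M ∉ withPhases ω S ∧
      w = (weight a b : ℕ∞)}

end Paulis

section Erasures

variable {p : ℕ} [Fact p.Prime] {N : Type} [Fintype N] [DecidableEq N]

/-- The configuration that is `u` outside `T` and `t` on `T`. -/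
def glue (T : Finset N) (u : Basis p {j // j ∉ T}) (t : Basis p {j // j ∈ T}) : Basis p N :=
  fun j => if h : j ∈ T then t ⟨j, h⟩ else u ⟨j, h⟩

/-- Erasure of the qudits in `T`: the partial trace over `T`. -/
noncomputable def erase (T : Finset N) (ρ : Op p N) : Op p {j // j ∉ T} :=
  Matrix.of fun u v => ∑ t : Basis p {j // j ∈ T}, ρ (glue T u t) (glue T v t)

/-- A quantum channel (completely positive trace preserving map), in Kraus form. -/
def IsChannel {A B : Type} [Fintype A] [DecidableEq A] [Fintype B]
    (Φ : Matrix A A ℂ → Matrix B B ℂ) : Prop :=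
  ∃ (m : ℕ) (K : Fin m → Matrix B A ℂ), ∑ i, (K i)ᴴ * K i = 1 ∧
    ∀ ρ, Φ ρ = ∑ i, K i * ρ * (K i)ᴴ

/-- The (unnormalized) pure state `|v⟩⟨v|`. -/
noncomputable def pureState {A : Type} (v : A → ℂ) : Matrix A A ℂ := Matrix.vecMulVec v (star v)

/-- The code `Q` corrects the erasure of the qudits in `T`: some channel on the remaining qudits
restores every state of `Q`. -/
def CodeCorrects (Q : Submodule ℂ (Basis p N → ℂ)) (T : Finset N) : Prop :=
  ∃ Φ : Op p {j // j ∉ T} → Op p N, IsChannel Φ ∧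
    ∀ v ∈ Q, Φ (erase T (pureState v)) = pureState v

/-- The information qudits encoded by `V` can be restored after erasure of the qudits in `T`, that
is, from the qudits outside `T`. -/
def EncoderCorrects {k : ℕ} (V : Matrix (Basis p N) (Basis p (Fin k)) ℂ) (T : Finset N) : Prop :=
  ∃ Φ : Op p {j // j ∉ T} → Op p (Fin k), IsChannel Φ ∧
    ∀ ψ : Basis p (Fin k) → ℂ, Φ (erase T (pureState (V *ᵥ ψ))) = pureState ψ

end Erasures

section EntanglementAssisted

variable {p : ℕ} [Fact p.Prime] {N : Type} [Fintype N] [DecidableEq N]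

/-- The operator `A ⊗ B` on all qudits, with `A` acting on the qudits outside `J` (those of the
sender) and `B` on the qudits in `J` (the receiver's halves of the entangled pairs). -/
noncomputable def joint (J : Finset N) (A : Op p {j // j ∉ J}) (B : Op p {j // j ∈ J}) : Op p N :=
  Matrix.of fun x y =>
    A (fun j => x j.1) (fun j => y j.1) * B (fun j => x j.1) (fun j => y j.1)

/-- The map `|ψ⟩ ↦ p^{-c/2} ∑_i |i⟩ |0⟩^{⊗ ℓ} |ψ⟩ |i⟩`, `c = |J|`: the receiver holds the last `|i⟩`
(the qudits in `J`), the sender holds the others. The labelling `e` says which qudits of the sender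
are his halves of the pairs, which are ancillas, and which carry the information. -/
noncomputable def prepare (J : Finset N) {ℓ k : ℕ}
    (e : {j // j ∈ J} ⊕ (Fin ℓ ⊕ Fin k) ≃ {j // j ∉ J}) :
    Matrix (Basis p N) (Basis p (Fin k)) ℂ :=
  Matrix.of fun x s =>
    if (∀ j : {j // j ∈ J}, x (e (Sum.inl j)).1 = x j.1) ∧
        (∀ a : Fin ℓ, x (e (Sum.inr (Sum.inl a))).1 = 0) ∧
        (∀ b : Fin k, x (e (Sum.inr (Sum.inr b))).1 = s b)
      then ((Real.sqrt ((p : ℝ) ^ J.card))⁻¹ : ℂ) else 0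

/-- The encoding `|ψ⟩ ↦ (U ⊗ I) |Ψ⟩`, `|Ψ⟩ = p^{-c/2} ∑_i |i⟩ |0⟩ |ψ⟩ |i⟩`. -/
noncomputable def encoder (J : Finset N) (U : UnitaryOp p {j // j ∉ J}) {ℓ k : ℕ}
    (e : {j // j ∈ J} ⊕ (Fin ℓ ⊕ Fin k) ≃ {j // j ∉ J}) :
    Matrix (Basis p N) (Basis p (Fin k)) ℂ :=
  joint J (U : Op p {j // j ∉ J}) 1 * prepare J e

/-- The position, among the sender's qudits, on which `Z_(j)` acts. -/
def posZ (J : Finset N) {ℓ k : ℕ} (e : {j // j ∈ J} ⊕ (Fin ℓ ⊕ Fin k) ≃ {j // j ∉ J}) :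
    {j // j ∈ J} ⊕ Fin ℓ → {j // j ∉ J} :=
  Sum.elim (fun i => e (Sum.inl i)) (fun a => e (Sum.inr (Sum.inl a)))

/-- The extended generators: `X̄_i ⊗ X_p^{μ_i}` (`i ∈ J`), `Z̄_i ⊗ Z_ω⁻¹` (`i ∈ J`) and `Z̄_a ⊗ I`
(`a` an ancilla), the second factor acting on the receiver's `i`-th qudit. -/
def extendedGenerators (ω : ℂ) (J : Finset N) {ℓ : ℕ}
    (Zb : {j // j ∈ J} ⊕ Fin ℓ → UnitaryOp p {j // j ∉ J})
    (Xb : {j // j ∈ J} → UnitaryOp p {j // j ∉ J}) (μ : {j // j ∈ J} → ℕ) :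
    Set (UnitaryOp p N) :=
  {M | (∃ i, (M : Op p N) = joint J (Xb i : Op p _) (single i (shift p ^ μ i))) ∨
    (∃ i, (M : Op p N) = joint J (Zb (Sum.inl i) : Op p _) (single i (clock p ω)⁻¹)) ∨
    (∃ a, (M : Op p N) = joint J (Zb (Sum.inr a) : Op p _) 1)}

/-- `(G, G', U)`, together with the labelling `e` of the sender's qudits, is an
`[[|N| - |J|, k, d; |J|]]_p` entanglement-assisted code. The sender holds the qudits outside `J`, the
receiver's halves of the `|J|` maximally entangled pairs are the qudits in `J`, and there are
`ℓ = (|N| - |J|) - |J| - k` ancillas. -/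
structure IsEAQECC (ω : ℂ) (J : Finset N) (G : Subgroup (UnitaryOp p {j // j ∉ J}))
    (G' : Subgroup (UnitaryOp p N)) (U : UnitaryOp p {j // j ∉ J}) {ℓ k : ℕ}
    (e : {j // j ∈ J} ⊕ (Fin ℓ ⊕ Fin k) ≃ {j // j ∉ J}) (d : ℕ∞) : Prop where
  /-- `G` is a non-abelian subgroup of the error group of the sender. -/
  subgroup : (G : Set (UnitaryOp p {j // j ∉ J})) ⊆ errorGroup ω {j // j ∉ J}
  nonabelian : ¬ ∀ A ∈ G, ∀ B ∈ G, A * B = B * A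
  /-- `G'` is a stabilizer on all the qudits. -/
  stabilizer : IsStabilizer ω G'
  /-- `G` has generators `Z̄`, `X̄` with the required commutation relations, `U` carries
  `X_(i) = X_p^{μ_i}` and `Z_(j) = Z_ω` to them up to phases, and the extended generators generate
  `G'` up to the scalars that `G'` contains. -/
  generators : ∃ (Zb : {j // j ∈ J} ⊕ Fin ℓ → UnitaryOp p {j // j ∉ J})
      (Xb : {j // j ∈ J} → UnitaryOp p {j // j ∉ J}) (μ : {j // j ∈ J} → ℕ),
    G = Subgroup.closure (Set.range Zb ∪ Set.range Xb) ∧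
    (∀ i j, Xb i * Xb j = Xb j * Xb i) ∧
    (∀ i j, Zb i * Zb j = Zb j * Zb i) ∧
    (∀ i j, j ≠ Sum.inl i → Xb i * Zb j = Zb j * Xb i) ∧
    (∀ i, Xb i * Zb (Sum.inl i) ≠ Zb (Sum.inl i) * Xb i) ∧
    (∀ i, (Xb i * Zb (Sum.inl i) : Op p {j // j ∉ J}) =
      (ω ^ μ i)⁻¹ • (Zb (Sum.inl i) * Xb i : Op p {j // j ∉ J})) ∧
    (∀ i, ∃ c : ℂ, (Xb i : Op p {j // j ∉ J}) =
      c • ((U : Op p {j // j ∉ J}) * single (e (Sum.inl i)) (shift p ^ μ i) *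
        (U : Op p {j // j ∉ J})ᴴ)) ∧
    (∀ j, ∃ c : ℂ, (Zb j : Op p {j // j ∉ J}) =
      c • ((U : Op p {j // j ∉ J}) * single (posZ J e j) (clock p ω) *
        (U : Op p {j // j ∉ J})ᴴ)) ∧
    extendedGenerators ω J Zb Xb μ ⊆ G' ∧
    G' = Subgroup.closure (extendedGenerators ω J Zb Xb μ ∪
      {M | M ∈ G' ∧ ∃ c : ℂ, (M : Op p N) = c • (1 : Op p N)})
  /-- The encoded states form a stabilizer code `Q(G')`. -/
  codeSpace : IsStabilizerCode G' (LinearMap.range (encoder J U e).mulVecLin)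
  /-- `d` is the minimum distance of `G'`. -/
  distance : minDistance ω G' = d

/-- The shares in `J` of the pure-state scheme with encoder `V` can be distributed before the secret
is given: a fixed state `φ` of a memory of the dealer and the shares in `J` is prepared first, and
the remaining shares are then produced by an isometry `W` from the memory and the secret. -/
def AdvanceShareable {k : ℕ} (V : Matrix (Basis p N) (Basis p (Fin k)) ℂ) (J : Finset N) : Prop :=
  ∃ (D : ℕ) (φ : Fin D → Basis p {j // j ∈ J} → ℂ)
    (W : Matrix (Basis p {j // j ∉ J}) (Fin D × Basis p (Fin k)) ℂ),
    ∑ m, ∑ t, ‖φ m t‖ ^ 2 = 1 ∧ Wᴴ * W = 1 ∧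
    ∀ x s, V x s = ∑ m, W (fun j => x j.1) (m, s) * φ m (fun j => x j.1)

end EntanglementAssisted

end QSS

open scoped Matrix

set_option linter.unusedSectionVars false

/-! Modulo phases, Pauli operators are vectors `(a|b)` over `ZMod p`, and commutation is the
symplectic form `symp`. Conditions 1 and 2 supply vectors `ρ i`, `σ i` of `f(S)` whose parts on `J`
are exactly `X_i` and `Z_i⁻¹`. Together with a basis `τ` of the vectors of `f(S)` that vanish on `J`
they form a basis `γ` of `f(S)` (`exists_adapted_basis`). Any two vectors of `f(S)` are orthogonal,
because their operators share an eigenvector in `Q`. Hence the outside parts have the opposite of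
the products of the inside parts: they anticommute in the generalized sense exactly within a pair `ρ
i`, `σ i`. They are the generators of `SJ`, with every `μ i = 1`.

The unitary is read off from the code. An orthonormal basis of `Q` is translated by Pauli operators
`κ α` that change only the eigenvalues of the `τ a`, by the phases `α a`. Each resulting vector `w α
s` is cut into slices, one for each configuration `t` of the qudits in `J`. The generators `τ` make
slices with different `α` orthogonal, the `σ` do so for different `t`, and the `ρ` show that the
slices for all `t` have the same Gram matrix. Rescaled by `p^{c/2}`, `c = |J|`, the slices are
therefore orthonormal (`EigenFrame.dotProduct_slice`). The trace formula `finrank_eigenspace_mul`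
gives `c + ℓ + k = n - c`, so they are the columns of a square, hence unitary, matrix.

Slicing the eigenvalue equations shows that this matrix conjugates one-qudit `X` and `Z` to the
generators, and reassembling the slices with `α = 0` shows that the encoder is an isometry onto `Q`.
The claim on erasures follows from that isometry, the one on advance sharing from the form of the
encoder. -/

namespace QSS

/-! ### Weyl operators, their commutation phases and traces -/

section Weyl

variable {p : ℕ} [Fact p.Prime] {N : Type} [Fintype N] [DecidableEq N] {ω : ℂ}

/-- The additive character `x ↦ ω ^ x` of `ZMod p`. -/
noncomputable def phase (hω : IsPrimitiveRoot ω p) : AddChar (ZMod p) ℂ :=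
  AddChar.zmodChar p hω.pow_eq_one

theorem phase_apply (hω : IsPrimitiveRoot ω p) (x : ZMod p) : phase hω x = ω ^ x.val :=
  AddChar.zmodChar_apply _ _

theorem phase_natCast (hω : IsPrimitiveRoot ω p) (i : ℕ) : phase hω (i : ZMod p) = ω ^ i :=
  AddChar.zmodChar_apply' _ _

theorem phase_sum (hω : IsPrimitiveRoot ω p) {ι : Type} (s : Finset ι) (f : ι → ZMod p) :
    phase hω (∑ i ∈ s, f i) = ∏ i ∈ s, phase hω (f i) := by
  classical
  induction s using Finset.induction_on with
  | empty => simp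
  | insert i s hi ih =>
    rw [Finset.sum_insert hi, Finset.prod_insert hi, AddChar.map_add_eq_mul, ih]

theorem phase_ne_zero (hω : IsPrimitiveRoot ω p) (x : ZMod p) : phase hω x ≠ 0 := by
  rw [phase_apply]
  exact pow_ne_zero _ (hω.ne_zero (Fact.out : p.Prime).ne_zero)

theorem norm_phase (hω : IsPrimitiveRoot ω p) (x : ZMod p) : ‖phase hω x‖ = 1 := by
  rw [phase_apply, norm_pow, hω.norm'_eq_one (Fact.out : p.Prime).ne_zero, one_pow]

theorem star_phase (hω : IsPrimitiveRoot ω p) (x : ZMod p) :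
    star (phase hω x) = phase hω (-x) := by
  rw [AddChar.map_neg_eq_inv, Complex.inv_eq_conj (norm_phase hω x)]
  rfl

theorem star_phase_mul_self (hω : IsPrimitiveRoot ω p) (x : ZMod p) :
    star (phase hω x) * phase hω x = 1 := by
  rw [star_phase, ← AddChar.map_add_eq_mul, neg_add_cancel, AddChar.map_zero_eq_one]

theorem phase_eq_one_iff (hω : IsPrimitiveRoot ω p) {x : ZMod p} : phase hω x = 1 ↔ x = 0 := by
  rw [phase_apply, hω.pow_eq_one_iff_dvd]
  constructor
  · intro h
    exact (ZMod.val_eq_zero x).1 (Nat.eq_zero_of_dvd_of_lt h (ZMod.val_lt x))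
  · rintro rfl
    simp

/-- The operator `M(a|b)` of the vector `v = (a|b)`. -/
noncomputable def weyl (ω : ℂ) (v : N ⊕ N → ZMod p) : Op p N :=
  pauli ω (fun j => v (Sum.inl j)) (fun j => v (Sum.inr j))

/-- The symplectic form `b · a' - b' · a` of `(a|b)` and `(a'|b')`. -/
def symp (u v : N ⊕ N → ZMod p) : ZMod p :=
  ∑ j, (u (Sum.inr j) * v (Sum.inl j) - v (Sum.inr j) * u (Sum.inl j))

theorem shift_pow_apply (a x y : ZMod p) :
    (shift p ^ a.val) x y = if x = y + a then 1 else 0 := by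
  have key : ∀ (m : ℕ) (x y : ZMod p), (shift p ^ m) x y = if x = y + m then 1 else 0 := by
    intro m
    induction m with
    | zero => intro x y; simp [Matrix.one_apply]
    | succ m ih =>
      intro x y
      rw [pow_succ, Matrix.mul_apply]
      simp only [ih, ite_mul, one_mul, zero_mul]
      simp only [shift, Matrix.of_apply, ← ite_and]
      rw [Finset.sum_eq_single (y + 1)]
      · simp [add_assoc, add_comm (1 : ZMod p)]
      · intro z _ hz
        rw [if_neg fun h => hz h.2]
      · simp
  rw [key, ZMod.natCast_zmod_val]

theorem clock_pow_apply (hω : IsPrimitiveRoot ω p) (b x y : ZMod p) :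
    (clock p ω ^ b.val) x y = if x = y then phase hω (b * y) else 0 := by
  rw [clock, Matrix.diagonal_pow, Matrix.diagonal_apply]
  by_cases h : x = y
  · subst h
    rw [if_pos rfl, if_pos rfl, Pi.pow_apply, ← phase_apply hω, ← AddChar.map_nsmul_eq_pow,
      nsmul_eq_mul, ZMod.natCast_zmod_val]
  · rw [if_neg h, if_neg h]

theorem weyl_apply (hω : IsPrimitiveRoot ω p) (v : N ⊕ N → ZMod p) (x y : Basis p N) :
    weyl ω v x y = if x = y + v ∘ Sum.inl then phase hω (∑ j, v (Sum.inr j) * y j) else 0 := by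
  have h1 : ∀ a b x y : ZMod p, (shift p ^ a.val * clock p ω ^ b.val) x y =
      if x = y + a then phase hω (b * y) else 0 := by
    intro a b x y
    rw [Matrix.mul_apply]
    simp only [shift_pow_apply, clock_pow_apply hω, mul_ite, mul_zero]
    rw [Finset.sum_ite_eq']
    simp
  simp only [weyl, pauli, tensor, Matrix.of_apply, h1]
  by_cases h : x = y + v ∘ Sum.inl
  · rw [if_pos h, phase_sum]
    refine Finset.prod_congr rfl fun j _ => ?_
    rw [if_pos]
    rw [h]; rfl
  · rw [if_neg h]
    obtain ⟨j, hj⟩ := Function.ne_iff.1 h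
    exact Finset.prod_eq_zero (Finset.mem_univ j) (if_neg hj)

theorem weyl_mulVec (hω : IsPrimitiveRoot ω p) (v : N ⊕ N → ZMod p) (w : Basis p N → ℂ)
    (x : Basis p N) :
    (weyl ω v *ᵥ w) x = phase hω (∑ j, v (Sum.inr j) * (x j - v (Sum.inl j))) *
      w (x - v ∘ Sum.inl) := by
  simp only [Matrix.mulVec, dotProduct, weyl_apply hω, ite_mul, zero_mul]
  simp_rw [← sub_eq_iff_eq_add]
  rw [Finset.sum_ite_eq, if_pos (Finset.mem_univ _)]
  rfl

theorem ext_mulVec {A B : Type} [Fintype B] {M M' : Matrix A B ℂ}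
    (h : ∀ w, M *ᵥ w = M' *ᵥ w) : M = M' := by
  classical
  refine Matrix.ext_of_mulVec_single fun i => h _

/-- The phase comes from moving the `Z` part of `u` past the `X` part of `v`. -/
theorem weyl_mul (hω : IsPrimitiveRoot ω p) (u v : N ⊕ N → ZMod p) :
    weyl ω u * weyl ω v = phase hω (∑ j, u (Sum.inr j) * v (Sum.inl j)) • weyl ω (u + v) := by
  refine ext_mulVec fun w => funext fun x => ?_
  rw [← Matrix.mulVec_mulVec, Matrix.smul_mulVec, Pi.smul_apply, weyl_mulVec hω, weyl_mulVec hω,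
    weyl_mulVec hω, smul_eq_mul, ← mul_assoc, ← mul_assoc, ← AddChar.map_add_eq_mul,
    ← AddChar.map_add_eq_mul, ← Finset.sum_add_distrib, ← Finset.sum_add_distrib]
  congr 2
  · refine Finset.sum_congr rfl fun j _ => ?_
    simp only [Pi.sub_apply, Pi.add_apply, Function.comp_apply]
    ring
  · funext j
    simp only [Pi.sub_apply, Pi.add_apply, Function.comp_apply]
    ring

theorem weyl_mul_comm (hω : IsPrimitiveRoot ω p) (u v : N ⊕ N → ZMod p) :
    weyl ω u * weyl ω v = phase hω (symp u v) • (weyl ω v * weyl ω u) := by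
  rw [weyl_mul hω, weyl_mul hω, smul_smul, ← AddChar.map_add_eq_mul, symp,
    ← Finset.sum_add_distrib, add_comm v u]
  simp

theorem weyl_zero (hω : IsPrimitiveRoot ω p) : weyl ω (0 : N ⊕ N → ZMod p) = 1 := by
  refine ext_mulVec fun w => funext fun x => ?_
  rw [weyl_mulVec hω]
  simp

theorem weyl_conjTranspose_mul_self (hω : IsPrimitiveRoot ω p) (v : N ⊕ N → ZMod p) :
    (weyl ω v)ᴴ * weyl ω v = 1 := by
  ext x y
  simp only [Matrix.mul_apply, Matrix.conjTranspose_apply, weyl_apply hω, mul_ite, mul_zero]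
  rw [Finset.sum_ite_eq', if_pos (Finset.mem_univ _), Matrix.one_apply]
  by_cases h : x = y
  · subst h
    rw [if_pos rfl, if_pos rfl, star_phase_mul_self]
  · rw [if_neg h, if_neg]
    · simp
    · intro h'
      exact h (add_right_cancel h').symm

/-- A nonzero shift leaves no diagonal entries; without a shift the trace is the sum of a nontrivial
additive character. -/
theorem trace_weyl (hω : IsPrimitiveRoot ω p) {v : N ⊕ N → ZMod p} (hv : v ≠ 0) :
    (weyl ω v).trace = 0 := by
  simp only [Matrix.trace, Matrix.diag_apply, weyl_apply hω]
  by_cases h : v ∘ Sum.inl = 0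
  · simp only [h, add_zero, if_true]
    obtain ⟨j, hj⟩ : ∃ j, v (Sum.inr j) ≠ 0 := by
      by_contra! hc
      apply hv
      funext j
      rcases j with j | j
      · exact congrFun h j
      · exact hc j
    let χ : AddChar (Basis p N) ℂ :=
      { toFun := fun y => phase hω (∑ j, v (Sum.inr j) * y j)
        map_zero_eq_one' := by simp
        map_add_eq_mul' := fun a b => by
          rw [← AddChar.map_add_eq_mul, ← Finset.sum_add_distrib]
          simp [mul_add] }
    refine AddChar.sum_eq_zero_of_ne_one (ψ := χ) fun hχ => hj ?_
    have h1 : χ (Pi.single j 1) = 1 := by rw [hχ]; rfl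
    have h2 : phase hω (∑ i, v (Sum.inr i) * (Pi.single j 1 : Basis p N) i) = 1 := h1
    rw [phase_eq_one_iff hω] at h2
    simpa [Pi.single_apply] using h2
  · refine Finset.sum_eq_zero fun x _ => if_neg fun hx => h ?_
    simpa using hx

/-- Isometries preserve inner products. -/
theorem star_mulVec_dotProduct_mulVec {A B : Type} [Fintype A] [Fintype B] [DecidableEq B]
    {M : Matrix A B ℂ} (hM : Mᴴ * M = 1) (w w' : B → ℂ) :
    star (M *ᵥ w) ⬝ᵥ (M *ᵥ w') = star w ⬝ᵥ w' := by
  rw [Matrix.star_mulVec, Matrix.dotProduct_mulVec, Matrix.vecMul_vecMul, hM, Matrix.vecMul_one]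

theorem mem_errorGroup_iff (hω : IsPrimitiveRoot ω p) {M : UnitaryOp p N} :
    M ∈ errorGroup ω N ↔ ∃ (c : ZMod p) (v : N ⊕ N → ZMod p), (M : Op p N) = phase hω c • weyl ω v := by
  constructor
  · rintro ⟨i, a, b, h⟩
    refine ⟨i, Sum.elim a b, ?_⟩
    rw [h, phase_natCast]
    rfl
  · rintro ⟨c, v, h⟩
    refine ⟨c.val, fun j => v (Sum.inl j), fun j => v (Sum.inr j), ?_⟩
    rw [h, phase_apply]
    rfl

/-- The error group as a subgroup of the unitary group. -/
noncomputable def errorSubgroup (hω : IsPrimitiveRoot ω p) (N : Type) [Fintype N] [DecidableEq N] :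
    Subgroup (UnitaryOp p N) where
  carrier := errorGroup ω N
  one_mem' := (mem_errorGroup_iff hω).2 ⟨0, 0, by simp [weyl_zero hω]⟩
  mul_mem' := by
    intro A B hA hB
    obtain ⟨c, u, hA⟩ := (mem_errorGroup_iff hω).1 hA
    obtain ⟨c', v, hB⟩ := (mem_errorGroup_iff hω).1 hB
    refine (mem_errorGroup_iff hω).2 ⟨c + c' + ∑ j, u (Sum.inr j) * v (Sum.inl j), u + v, ?_⟩
    rw [Submonoid.coe_mul, hA, hB, Matrix.smul_mul, Matrix.mul_smul, weyl_mul hω, smul_smul,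
      smul_smul, AddChar.map_add_eq_mul, AddChar.map_add_eq_mul, mul_assoc]
  inv_mem' := by
    intro A hA
    obtain ⟨c, u, hA⟩ := (mem_errorGroup_iff hω).1 hA
    -- The sum cancels the phase that `weyl_mul` produces in `weyl u * weyl (-u)`.
    refine (mem_errorGroup_iff hω).2 ⟨-c + ∑ j, u (Sum.inr j) * u (Sum.inl j), -u, ?_⟩
    have h : (A : Op p N) *
        (phase hω (-c + ∑ j, u (Sum.inr j) * u (Sum.inl j)) • weyl ω (-u)) = 1 := by
      rw [hA, Matrix.smul_mul, Matrix.mul_smul, weyl_mul hω, smul_smul, smul_smul,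
        ← AddChar.map_add_eq_mul, ← AddChar.map_add_eq_mul, add_neg_cancel, weyl_zero hω]
      simp
    have h' : ((A⁻¹ : UnitaryOp p N) : Op p N) * (A : Op p N) = 1 := by
      rw [← Submonoid.coe_mul, inv_mul_cancel]; rfl
    exact left_inv_eq_right_inv h' h

theorem coe_errorSubgroup (hω : IsPrimitiveRoot ω p) :
    (errorSubgroup hω N : Set (UnitaryOp p N)) = errorGroup ω N := rfl

end Weyl

end QSS

namespace QSS

/-! ### Splitting the register into `J` and its complement -/

section Slices

variable {p : ℕ} [Fact p.Prime] {N : Type} [Fintype N] [DecidableEq N] {ω : ℂ}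

/-- The part of `(a|b)` that belongs to the qudits outside `J`. -/
def outside (J : Finset N) (v : N ⊕ N → ZMod p) : {j // j ∉ J} ⊕ {j // j ∉ J} → ZMod p :=
  v ∘ Sum.map Subtype.val Subtype.val

/-- The part of `(a|b)` that belongs to the qudits in `J`. -/
def inside (J : Finset N) (v : N ⊕ N → ZMod p) : {j // j ∈ J} ⊕ {j // j ∈ J} → ZMod p :=
  v ∘ Sum.map Subtype.val Subtype.val

theorem sum_split (J : Finset N) {M : Type} [AddCommMonoid M] (f : N → M) :
    ∑ j, f j = ∑ j : {j // j ∉ J}, f j.1 + ∑ j : {j // j ∈ J}, f j.1 := by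
  rw [add_comm, ← Fintype.sum_subtype_add_sum_subtype (fun j => j ∈ J) f]
  congr!

/-- For orthogonal `u`, `v` this makes the products of the two parts opposite, which is the source
of the noncommuting pairs. -/
theorem symp_split (J : Finset N) (u v : N ⊕ N → ZMod p) :
    symp u v = symp (outside J u) (outside J v) + symp (inside J u) (inside J v) := by
  rw [symp, sum_split J]
  rfl

theorem joint_weyl (hω : IsPrimitiveRoot ω p) (J : Finset N) (v : N ⊕ N → ZMod p) :
    joint J (weyl ω (outside J v)) (weyl ω (inside J v)) = weyl ω v := by
  ext x y
  rw [joint, Matrix.of_apply, weyl_apply hω, weyl_apply hω, weyl_apply hω, sum_split J,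
    AddChar.map_add_eq_mul]
  by_cases h : x = y + v ∘ Sum.inl
  · subst h
    rw [if_pos, if_pos, if_pos rfl]
    · rfl
    · rfl
    · rfl
  · rw [if_neg h]
    by_cases h1 : (fun j : {j // j ∉ J} => x j.1) = (fun j => y j.1) + outside J v ∘ Sum.inl
    · rw [mul_eq_zero]
      right
      rw [if_neg]
      · intro h2
        apply h
        funext j
        by_cases hj : j ∈ J
        · exact congrFun h2 ⟨j, hj⟩
        · exact congrFun h1 ⟨j, hj⟩
    · rw [if_neg h1, zero_mul]

theorem joint_smul_left (J : Finset N) (c : ℂ) (A : Op p {j // j ∉ J}) (B : Op p {j // j ∈ J}) :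
    joint J (c • A) B = c • joint J A B := by
  ext x y
  simp [joint, mul_assoc]

/-- The exponent is kept visible because the generators are used with `μ i = 1`. -/
theorem single_shift (ω : ℂ) (i : N) :
    (single i (shift p ^ 1) : Op p N) = weyl ω (Sum.elim (Pi.single i 1) 0) := by
  rw [single, weyl, pauli]
  congr 1
  funext j
  have := Fact.mk (Fact.out : p.Prime).one_lt
  by_cases h : j = i
  · subst h
    simp [ZMod.val_one]
  · simp [h]

theorem clock_inv (hω : IsPrimitiveRoot ω p) :
    (clock p ω)⁻¹ = clock p ω ^ (-1 : ZMod p).val := by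
  have := Fact.mk (Fact.out : p.Prime).one_lt
  refine Matrix.inv_eq_right_inv ?_
  have h1 : clock p ω = Matrix.diagonal fun y => phase hω y := by
    rw [clock]
    exact congrArg _ (funext fun y => (phase_apply hω y).symm)
  have h2 : clock p ω ^ (-1 : ZMod p).val = Matrix.diagonal fun y => phase hω (-1 * y) := by
    ext x y
    rw [clock_pow_apply hω, Matrix.diagonal_apply]
    by_cases h : x = y <;> simp [h]
  rw [h2, h1, Matrix.diagonal_mul_diagonal, ← Matrix.diagonal_one]
  congr 1
  funext y
  rw [← AddChar.map_add_eq_mul]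
  simp

theorem single_clock_pow (ω : ℂ) (i : N) (b : ZMod p) :
    (single i (clock p ω ^ b.val) : Op p N) = weyl ω (Sum.elim 0 (Pi.single i b)) := by
  rw [single, weyl, pauli]
  congr 1
  funext j
  by_cases h : j = i
  · subst h
    simp
  · simp [h]

theorem single_clock (ω : ℂ) (i : N) :
    (single i (clock p ω) : Op p N) = weyl ω (Sum.elim 0 (Pi.single i 1)) := by
  have := Fact.mk (Fact.out : p.Prime).one_lt
  rw [← single_clock_pow, ZMod.val_one, pow_one]

theorem single_clock_inv (hω : IsPrimitiveRoot ω p) (i : N) :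
    (single i (clock p ω)⁻¹ : Op p N) = weyl ω (Sum.elim 0 (Pi.single i (-1))) := by
  rw [clock_inv hω, single_clock_pow]

/-- The component of `w` on which the qudits in `J` are in the state `|t⟩`. -/
def slice (J : Finset N) (w : Basis p N → ℂ) (t : Basis p {j // j ∈ J}) :
    Basis p {j // j ∉ J} → ℂ :=
  fun x => w (glue J x t)

theorem glue_of_mem (J : Finset N) (u : Basis p {j // j ∉ J}) (t : Basis p {j // j ∈ J})
    (j : {j // j ∈ J}) : glue J u t j.1 = t j := by
  simp [glue]

theorem glue_of_notMem (J : Finset N) (u : Basis p {j // j ∉ J}) (t : Basis p {j // j ∈ J})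
    (j : {j // j ∉ J}) : glue J u t j.1 = u j := by
  simp [glue, j.2]

theorem glue_restrict (J : Finset N) (x : Basis p N) :
    glue J (fun j => x j.1) (fun j => x j.1) = x := by
  funext j
  simp [glue]

theorem glue_sub (J : Finset N) (u u' : Basis p {j // j ∉ J}) (t t' : Basis p {j // j ∈ J}) :
    glue J (u - u') (t - t') = glue J u t - glue J u' t' := by
  funext j
  by_cases h : j ∈ J <;> simp [glue, h]

/-- A configuration of the register is a configuration outside `J` and one in `J`. -/
def glueEquiv (J : Finset N) : Basis p {j // j ∉ J} × Basis p {j // j ∈ J} ≃ Basis p N where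
  toFun z := glue J z.1 z.2
  invFun x := (fun j => x j.1, fun j => x j.1)
  left_inv z := Prod.ext (funext fun j => glue_of_notMem J z.1 z.2 j)
    (funext fun j => glue_of_mem J z.1 z.2 j)
  right_inv x := glue_restrict J x

theorem sum_glue (J : Finset N) (f : Basis p N → ℂ) :
    ∑ x, f x = ∑ t, ∑ u, f (glue J u t) := by
  rw [← (glueEquiv J).sum_comp, Fintype.sum_prod_type_right]
  rfl

theorem sum_slice_dotProduct (J : Finset N) (w w' : Basis p N → ℂ) :
    ∑ t, star (slice J w t) ⬝ᵥ slice J w' t = star w ⬝ᵥ w' := by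
  rw [dotProduct, sum_glue J]
  rfl

/-- The part on `J` only shifts the index of the slice and contributes a scalar; the outside part
acts on the slice itself. -/
theorem slice_weyl_mulVec (hω : IsPrimitiveRoot ω p) (J : Finset N) (v : N ⊕ N → ZMod p)
    (w : Basis p N → ℂ) (t : Basis p {j // j ∈ J}) :
    slice J (weyl ω v *ᵥ w) t =
      phase hω (∑ j, inside J v (Sum.inr j) * (t j - inside J v (Sum.inl j))) •
        weyl ω (outside J v) *ᵥ slice J w (t - inside J v ∘ Sum.inl) := by
  funext x
  rw [Pi.smul_apply, slice, weyl_mulVec hω, weyl_mulVec hω, slice, glue_sub, sum_split J,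
    add_comm, AddChar.map_add_eq_mul, smul_eq_mul, mul_assoc]
  simp only [glue_of_mem, glue_of_notMem]
  congr 3
  congr 1
  exact (glue_restrict J _).symm

theorem slice_smul (J : Finset N) (c : ℂ) (w : Basis p N → ℂ) (t : Basis p {j // j ∈ J}) :
    slice J (c • w) t = c • slice J w t := rfl

/-- The inner products of the slices of two eigenvectors are permuted by translations, up to
phases. -/
theorem slice_dotProduct_of_eigenvector (hω : IsPrimitiveRoot ω p) (J : Finset N)
    {v : N ⊕ N → ZMod p} {w w' : Basis p N → ℂ} {a a' : ℂ} (hw : weyl ω v *ᵥ w = a • w)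
    (hw' : weyl ω v *ᵥ w' = a' • w') (t t' : Basis p {j // j ∈ J}) :
    star a * a' * (star (slice J w t) ⬝ᵥ slice J w' t') =
      phase hω (∑ j, inside J v (Sum.inr j) * (t' j - t j)) *
        (star (slice J w (t - inside J v ∘ Sum.inl)) ⬝ᵥ
          slice J w' (t' - inside J v ∘ Sum.inl)) := by
  have h : star a * a' * (star (slice J w t) ⬝ᵥ slice J w' t') =
      star (slice J (a • w) t) ⬝ᵥ slice J (a' • w') t' := by
    rw [slice_smul, slice_smul, star_smul, smul_dotProduct, dotProduct_smul, smul_eq_mul,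
      smul_eq_mul, mul_assoc]
  rw [h, ← hw, ← hw', slice_weyl_mulVec hω, slice_weyl_mulVec hω, star_smul, smul_dotProduct,
    dotProduct_smul, star_mulVec_dotProduct_mulVec (weyl_conjTranspose_mul_self hω _),
    smul_eq_mul, smul_eq_mul, ← mul_assoc, star_phase, ← AddChar.map_add_eq_mul,
    ← Finset.sum_neg_distrib, ← Finset.sum_add_distrib]
  congr 2
  exact Finset.sum_congr rfl fun j _ => by ring

end Slices

end QSS

namespace QSS

/-! ### Dimension of simultaneous eigenspaces -/

section Eigenspaces

variable {p : ℕ} [Fact p.Prime] {N : Type} [Fintype N] [DecidableEq N] {ω : ℂ}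

theorem star_dotProduct_self_ne_zero {A : Type} [Fintype A] {w : A → ℂ} (hw : w ≠ 0) :
    star w ⬝ᵥ w ≠ 0 := by
  open scoped ComplexOrder in
  exact fun h => hw (dotProduct_star_self_eq_zero.1 h)

theorem star_mul_self_of_eigenvector (hω : IsPrimitiveRoot ω p) {v : N ⊕ N → ZMod p}
    {w : Basis p N → ℂ} {a : ℂ} (hw : w ≠ 0) (h : weyl ω v *ᵥ w = a • w) : star a * a = 1 := by
  have h1 := star_mulVec_dotProduct_mulVec (weyl_conjTranspose_mul_self hω v) w w
  rw [h, star_smul, smul_dotProduct, dotProduct_smul, smul_eq_mul, smul_eq_mul, ← mul_assoc] at h1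
  exact mul_right_cancel₀ (star_dotProduct_self_ne_zero hw) (h1.trans (one_mul _).symm)

theorem ne_zero_of_eigenvector (hω : IsPrimitiveRoot ω p) {v : N ⊕ N → ZMod p}
    {w : Basis p N → ℂ} {a : ℂ} (hw : w ≠ 0) (h : weyl ω v *ᵥ w = a • w) : a ≠ 0 := by
  rintro rfl
  simpa using star_mul_self_of_eigenvector hω hw h

/-- The dimension of a simultaneous eigenspace of the Pauli operators of a space of vectors. -/
theorem finrank_eigenspace_mul (hω : IsPrimitiveRoot ω p)
    (F : Submodule (ZMod p) (N ⊕ N → ZMod p)) (lam : (N ⊕ N → ZMod p) → ℂ)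
    {Q : Submodule ℂ (Basis p N → ℂ)} (hQ0 : Q ≠ ⊥)
    (hQ : ∀ w, w ∈ Q ↔ ∀ v ∈ F, weyl ω v *ᵥ w = lam v • w) :
    Module.finrank ℂ Q * p ^ Module.finrank (ZMod p) F = p ^ Fintype.card N := by
  classical
  obtain ⟨w₀, hw₀Q, hw₀⟩ := Q.ne_bot_iff.1 hQ0
  have heig := (hQ w₀).1 hw₀Q
  have hlam0 : ∀ v ∈ F, lam v ≠ 0 := fun v hv => ne_zero_of_eigenvector hω hw₀ (heig v hv)
  -- On a common eigenvector the operators act by scalars, so the eigenvalues obey the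
  -- multiplication law of the Weyl operators, cocycle included.
  have hlam : ∀ u ∈ F, ∀ v ∈ F,
      lam u * lam v = phase hω (∑ j, u (Sum.inr j) * v (Sum.inl j)) * lam (u + v) := by
    intro u hu v hv
    have h := congrArg (fun M : Op p N => M *ᵥ w₀) (weyl_mul hω u v)
    simp only [← Matrix.mulVec_mulVec, Matrix.smul_mulVec, heig v hv, heig u hu,
      heig _ (F.add_mem hu hv), Matrix.mulVec_smul, smul_smul] at h
    rw [mul_comm]
    exact smul_left_injective ℂ hw₀ h
  have hone : lam 0 = 1 := by
    have h := heig 0 F.zero_mem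
    rw [weyl_zero hω, Matrix.one_mulVec] at h
    exact (smul_left_injective ℂ hw₀ (a₁ := 1) (a₂ := lam 0) (by simpa using h)).symm
  -- Group averaging: `A / |F|` projects onto `Q`, so its trace is the dimension. Only `v = 0`
  -- contributes to the trace.
  let A : Op p N := ∑ v : F, (lam v)⁻¹ • weyl ω (v : N ⊕ N → ZMod p)
  let c : ℂ := ((Fintype.card F : ℕ) : ℂ)
  have hc : c ≠ 0 := Nat.cast_ne_zero.2 Fintype.card_ne_zero
  have hA : ∀ u ∈ F, weyl ω u * A = lam u • A := by
    intro u hu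
    simp only [A]
    rw [Finset.mul_sum, Finset.smul_sum, ← Equiv.sum_comp (Equiv.addLeft (⟨u, hu⟩ : F))
      fun v : F => lam u • (lam v)⁻¹ • weyl ω (v : N ⊕ N → ZMod p)]
    refine Finset.sum_congr rfl fun v _ => ?_
    rw [Matrix.mul_smul, weyl_mul hω, smul_smul, smul_smul, Equiv.coe_addLeft,
      Submodule.coe_add]
    congr 1
    have h := hlam u hu v v.2
    have h1 := hlam0 v v.2
    have h2 := hlam0 _ (F.add_mem hu v.2)
    field_simp
    linear_combination -h
  have hproj : LinearMap.IsProj Q (Matrix.toLin' (c⁻¹ • A)) := by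
    refine ⟨fun w => (hQ _).2 fun v hv => ?_, fun w hw => ?_⟩
    · rw [Matrix.toLin'_apply, Matrix.mulVec_mulVec, Matrix.mul_smul, hA v hv, smul_comm,
        Matrix.smul_mulVec]
    · have hw' := (hQ w).1 hw
      simp only [Matrix.toLin'_apply, Matrix.smul_mulVec, A, Matrix.sum_mulVec]
      have : ∀ v : F, (lam v)⁻¹ • weyl ω (v : N ⊕ N → ZMod p) *ᵥ w = w := by
        intro v
        rw [hw' v v.2, smul_smul, inv_mul_cancel₀ (hlam0 v v.2), one_smul]
      rw [Finset.sum_congr rfl fun v _ => this v, Finset.sum_const, Finset.card_univ,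
        ← Nat.cast_smul_eq_nsmul ℂ, smul_smul, inv_mul_cancel₀ hc, one_smul]
  have htr := hproj.trace
  rw [Matrix.trace_toLin'_eq, Matrix.trace_smul, Matrix.trace_sum, Finset.sum_eq_single 0] at htr
  · rw [Matrix.trace_smul, ZeroMemClass.coe_zero, weyl_zero hω, hone, Matrix.trace_one] at htr
    have hF : Fintype.card F = p ^ Module.finrank (ZMod p) F := by
      rw [Module.card_eq_pow_finrank (K := ZMod p), ZMod.card]
    have hB : Fintype.card (Basis p N) = p ^ Fintype.card N := by
      rw [Fintype.card_fun, ZMod.card]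
    rw [← hF, ← hB]
    have : (Module.finrank ℂ Q : ℂ) * ((Fintype.card F : ℕ) : ℂ) = (Fintype.card (Basis p N) : ℂ) := by
      rw [← htr]
      simp only [inv_one, smul_eq_mul, one_mul]
      rw [mul_comm, ← mul_assoc, mul_inv_cancel₀ hc, one_mul]
    exact_mod_cast this
  · intro v _ hv
    rw [Matrix.trace_smul, trace_weyl hω (by simpa using hv), smul_zero]
  · simp

end Eigenspaces

end QSS

namespace QSS

/-! ### Encoders, eigenframes and the unitary made of slices -/

section Encoders

attribute [local instance 2000] Matrix.instHMulOfFintypeOfMulOfAddCommMonoid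

variable {p : ℕ} [Fact p.Prime] {N : Type} [Fintype N] [DecidableEq N] {ω : ℂ}
  {J : Finset N} {ℓ k : ℕ}

/-- The sender's configuration with values `t` on his halves of the pairs, `α` on the ancillas and
`s` on the information qudits. -/
def label (e : {j // j ∈ J} ⊕ (Fin ℓ ⊕ Fin k) ≃ {j // j ∉ J}) (t : Basis p {j // j ∈ J})
    (α : Basis p (Fin ℓ)) (s : Basis p (Fin k)) : Basis p {j // j ∉ J} :=
  fun j => Sum.elim t (Sum.elim α s) (e.symm j)

theorem eq_label_iff (e : {j // j ∈ J} ⊕ (Fin ℓ ⊕ Fin k) ≃ {j // j ∉ J})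
    (t : Basis p {j // j ∈ J}) (α : Basis p (Fin ℓ)) (s : Basis p (Fin k))
    (y : Basis p {j // j ∉ J}) :
    y = label e t α s ↔ (∀ j, y (e (Sum.inl j)) = t j) ∧ (∀ a, y (e (Sum.inr (Sum.inl a))) = α a) ∧
      ∀ b, y (e (Sum.inr (Sum.inr b))) = s b := by
  constructor
  · rintro rfl
    simp [label]
  · rintro ⟨h1, h2, h3⟩
    funext j
    obtain ⟨i, rfl⟩ := e.surjective j
    rcases i with i | i | i <;> simp [label, h1, h2, h3]

theorem label_injective (e : {j // j ∈ J} ⊕ (Fin ℓ ⊕ Fin k) ≃ {j // j ∉ J})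
    {t t' : Basis p {j // j ∈ J}} {α α' : Basis p (Fin ℓ)} {s s' : Basis p (Fin k)}
    (h : label e t α s = label e t' α' s') : t = t' ∧ α = α' ∧ s = s' := by
  obtain ⟨h1, h2, h3⟩ := (eq_label_iff e t' α' s' _).1 h
  refine ⟨funext fun j => ?_, funext fun j => ?_, funext fun j => ?_⟩
  · simpa [label] using h1 j
  · simpa [label] using h2 j
  · simpa [label] using h3 j

/-- The receiver's configuration fixes that of the sender's halves, so a single term of the matrix
product survives. -/
theorem encoder_apply (J : Finset N) (U : UnitaryOp p {j // j ∉ J})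
    (e : {j // j ∈ J} ⊕ (Fin ℓ ⊕ Fin k) ≃ {j // j ∉ J}) (x : Basis p N) (s : Basis p (Fin k)) :
    encoder J U e x s = (U : Op p {j // j ∉ J}) (fun j => x j.1) (label e (fun j => x j.1) 0 s) *
      ((Real.sqrt ((p : ℝ) ^ J.card))⁻¹ : ℂ) := by
  have hprep : ∀ u t, prepare J e (glue J u t) s =
      if u = label e t 0 s then ((Real.sqrt ((p : ℝ) ^ J.card))⁻¹ : ℂ) else 0 := by
    intro u t
    simp only [prepare, Matrix.of_apply, glue_of_mem, glue_of_notMem, eq_label_iff, Pi.zero_apply]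
  have hjoint : ∀ u t, joint J (U : Op p {j // j ∉ J}) 1 x (glue J u t) =
      if (fun j : {j // j ∈ J} => x j.1) = t then
        (U : Op p {j // j ∉ J}) (fun j => x j.1) u else 0 := by
    intro u t
    simp only [joint, Matrix.of_apply, glue_of_mem, glue_of_notMem, Matrix.one_apply, mul_ite,
      mul_one, mul_zero]
  change ∑ z, joint J (U : Op p {j // j ∉ J}) 1 x z * prepare J e z s = _
  rw [sum_glue J]
  simp only [hprep, hjoint]
  rw [Finset.sum_eq_single (fun j : {j // j ∈ J} => x j.1)]
  · rw [Finset.sum_eq_single (label e (fun j => x j.1) 0 s)]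
    · simp
    · intro u _ hu
      rw [if_neg hu, mul_zero]
    · simp
  · intro t _ ht
    refine Finset.sum_eq_zero fun u _ => ?_
    rw [if_neg (Ne.symm ht), zero_mul]
  · simp

theorem sq_inv_sqrt_pow (c : ℕ) :
    ((Real.sqrt ((p : ℝ) ^ c))⁻¹) ^ 2 = ((p : ℝ) ^ c)⁻¹ := by
  rw [inv_pow, Real.sq_sqrt (by positivity)]

/-- The receiver's halves of the pairs can be distributed before the secret is given. -/
theorem advanceShareable_encoder (J : Finset N) (U : UnitaryOp p {j // j ∉ J})
    (e : {j // j ∈ J} ⊕ (Fin ℓ ⊕ Fin k) ≃ {j // j ∉ J}) :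
    AdvanceShareable (encoder J U e) J := by
  have hp : (p : ℝ) ^ J.card ≠ 0 := pow_ne_zero _ (Nat.cast_ne_zero.2 (Fact.out : p.Prime).ne_zero)
  let E := Fintype.equivFin (Basis p {j // j ∈ J})
  -- The memory holds the sender's halves of the pairs, `φ` is the maximally entangled state, and
  -- `W` consists of the columns of `U` with ancillas `0`.
  refine ⟨Fintype.card (Basis p {j // j ∈ J}),
    fun m t => if E.symm m = t then ((Real.sqrt ((p : ℝ) ^ J.card))⁻¹ : ℂ) else 0,
    Matrix.of fun y z => (U : Op p {j // j ∉ J}) y (label e (E.symm z.1) 0 z.2), ?_, ?_, ?_⟩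
  · have h : ∀ m t, ‖(if E.symm m = t then ((Real.sqrt ((p : ℝ) ^ J.card))⁻¹ : ℂ) else 0)‖ ^ 2 =
        if E.symm m = t then ((p : ℝ) ^ J.card)⁻¹ else 0 := by
      intro m t
      split_ifs
      · rw [← sq_inv_sqrt_pow, norm_inv, Complex.norm_real, Real.norm_of_nonneg (Real.sqrt_nonneg _)]
      · simp
    simp only [h, Finset.sum_ite_eq, Finset.mem_univ, if_true, Finset.sum_const, Finset.card_univ,
      Fintype.card_fin, Fintype.card_fun, ZMod.card, Fintype.card_coe, nsmul_eq_mul, Nat.cast_pow]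
    exact mul_inv_cancel₀ hp
  · ext z z'
    have h := congrFun (congrFun (Matrix.mem_unitaryGroup_iff'.1 U.2) (label e (E.symm z.1) 0 z.2))
      (label e (E.symm z'.1) 0 z'.2)
    rw [Matrix.mul_apply] at h ⊢
    refine h.trans ?_
    rw [Matrix.one_apply, Matrix.one_apply]
    refine if_congr ⟨fun h' => ?_, fun h' => by rw [h']⟩ rfl rfl
    obtain ⟨h1, -, h3⟩ := label_injective e h'
    exact Prod.ext (E.symm.injective h1) h3
  · intro x s
    rw [encoder_apply, Finset.sum_eq_single (E fun j => x j.1)]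
    · simp
    · intro m _ hm
      refine mul_eq_zero_of_right _ (if_neg fun h => hm (E.symm_apply_eq.1 h))
    · simp

/-- An orthonormal family of simultaneous eigenvectors of Pauli operators `γ` that act as `X` and
`Z⁻¹` on the qudits in `J`, or trivially there. -/
structure EigenFrame (hω : IsPrimitiveRoot ω p) (J : Finset N)
    (γ : {j // j ∈ J} ⊕ ({j // j ∈ J} ⊕ Fin ℓ) → N ⊕ N → ZMod p)
    (lam : {j // j ∈ J} ⊕ ({j // j ∈ J} ⊕ Fin ℓ) → ℂ)
    (w : Basis p (Fin ℓ) → Basis p (Fin k) → Basis p N → ℂ) : Prop where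
  inside_x : ∀ i, inside J (γ (Sum.inl i)) = Sum.elim (Pi.single i 1) (0 : {j // j ∈ J} → ZMod p)
  inside_z : ∀ i, inside J (γ (Sum.inr (Sum.inl i))) = Sum.elim (0 : {j // j ∈ J} → ZMod p) (Pi.single i (-1))
  inside_a : ∀ a, inside J (γ (Sum.inr (Sum.inr a))) = 0
  norm_lam : ∀ g, star (lam g) * lam g = 1
  eigen_x : ∀ i α s, weyl ω (γ (Sum.inl i)) *ᵥ w α s = lam (Sum.inl i) • w α s
  eigen_z : ∀ i α s,
    weyl ω (γ (Sum.inr (Sum.inl i))) *ᵥ w α s = lam (Sum.inr (Sum.inl i)) • w α s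
  eigen_a : ∀ a α s, weyl ω (γ (Sum.inr (Sum.inr a))) *ᵥ w α s =
    (lam (Sum.inr (Sum.inr a)) * phase hω (α a)) • w α s
  translation : ∀ t : Basis p {j // j ∈ J}, ∃ a : ℂ, star a * a = 1 ∧
    ∀ α s, weyl ω (∑ i, t i • γ (Sum.inl i)) *ᵥ w α s = a • w α s
  orthonormal : ∀ α s s', star (w α s) ⬝ᵥ w α s' = if s = s' then 1 else 0

namespace EigenFrame

variable {hω : IsPrimitiveRoot ω p} {γ : {j // j ∈ J} ⊕ ({j // j ∈ J} ⊕ Fin ℓ) → N ⊕ N → ZMod p}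
  {lam : {j // j ∈ J} ⊕ ({j // j ∈ J} ⊕ Fin ℓ) → ℂ}
  {w : Basis p (Fin ℓ) → Basis p (Fin k) → Basis p N → ℂ}

/-- An ancilla generator is trivial on `J`, so it preserves the inner product of two slices; its
eigenvalues multiply that product by `ω^(α' a - α a)`, which is not `1` for some `a`. -/
theorem dotProduct_slice_of_ne_ancilla (h : EigenFrame hω J γ lam w) {α α' : Basis p (Fin ℓ)}
    (hα : α ≠ α') (s s' : Basis p (Fin k)) (t t' : Basis p {j // j ∈ J}) :
    star (slice J (w α s) t) ⬝ᵥ slice J (w α' s') t' = 0 := by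
  obtain ⟨a, ha⟩ := Function.ne_iff.1 hα
  have h1 := slice_dotProduct_of_eigenvector hω J (h.eigen_a a α s) (h.eigen_a a α' s') t t'
  rw [h.inside_a] at h1
  have h2 : star (lam (Sum.inr (Sum.inr a)) * phase hω (α a)) *
      (lam (Sum.inr (Sum.inr a)) * phase hω (α' a)) = phase hω (α' a - α a) := by
    rw [star_mul', star_phase, mul_mul_mul_comm, h.norm_lam, one_mul, ← AddChar.map_add_eq_mul,
      neg_add_eq_sub]
  have h3 : (0 : {j // j ∈ J} ⊕ {j // j ∈ J} → ZMod p) ∘ Sum.inl = 0 := rfl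
  rw [h2, h3, sub_zero, sub_zero] at h1
  simp only [Pi.zero_apply, zero_mul, Finset.sum_const_zero, AddChar.map_zero_eq_one, one_mul] at h1
  by_contra h0
  have h4 := mul_right_cancel₀ h0 (h1.trans (one_mul _).symm)
  rw [phase_eq_one_iff, sub_eq_zero] at h4
  exact ha h4.symm

/-- The generator acting as `Z⁻¹` on qudit `i` of `J` has the same eigenvalue on both vectors, yet
multiplies the inner product by `ω^(t i - t' i)`. -/
theorem dotProduct_slice_of_ne_pair (h : EigenFrame hω J γ lam w) (α : Basis p (Fin ℓ))
    (s s' : Basis p (Fin k)) {t t' : Basis p {j // j ∈ J}} (ht : t ≠ t') :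
    star (slice J (w α s) t) ⬝ᵥ slice J (w α s') t' = 0 := by
  obtain ⟨i, hi⟩ := Function.ne_iff.1 ht
  have h1 := slice_dotProduct_of_eigenvector hω J (h.eigen_z i α s) (h.eigen_z i α s') t t'
  rw [h.inside_z, h.norm_lam, one_mul, Sum.elim_comp_inl, sub_zero, sub_zero] at h1
  by_contra h0
  have h4 := mul_right_cancel₀ h0 (h1.symm.trans (one_mul _).symm)
  rw [phase_eq_one_iff] at h4
  simp [Pi.single_apply, sub_eq_zero] at h4
  exact hi h4

/-- The product of the `X`-type generators with exponents `t` relates slice `t` to slice `0` by an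
isometry and a phase. The phase does not depend on `s`, so it cancels. -/
theorem dotProduct_slice_eq_zero (h : EigenFrame hω J γ lam w) (α : Basis p (Fin ℓ))
    (s s' : Basis p (Fin k)) (t : Basis p {j // j ∈ J}) :
    star (slice J (w α s) t) ⬝ᵥ slice J (w α s') t =
      star (slice J (w α s) 0) ⬝ᵥ slice J (w α s') 0 := by
  obtain ⟨a, ha, hw⟩ := h.translation t
  have h1 := slice_dotProduct_of_eigenvector hω J (hw α s) (hw α s') t t
  have h2 : inside J (∑ i, t i • γ (Sum.inl i)) ∘ Sum.inl = t := by
    funext j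
    have h3 : ∀ i, γ (Sum.inl i) (Sum.inl j.1) = if j = i then 1 else 0 := by
      intro i
      have := congrFun (h.inside_x i) (Sum.inl j)
      simpa [inside, Pi.single_apply] using this
    simp [inside, h3]
  rw [h2, ha, one_mul, sub_self] at h1
  simpa using h1

/-- For equal `α`, the `p^|J|` slices contribute equally to the inner product of the whole vectors,
whence the factor. -/
theorem dotProduct_slice (h : EigenFrame hω J γ lam w) (α α' : Basis p (Fin ℓ))
    (s s' : Basis p (Fin k)) (t t' : Basis p {j // j ∈ J}) :
    (p : ℂ) ^ J.card * star (slice J (w α s) t) ⬝ᵥ slice J (w α' s') t' =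
      if t = t' ∧ α = α' ∧ s = s' then 1 else 0 := by
  by_cases hα : α = α'
  · subst hα
    by_cases ht : t = t'
    · subst ht
      have h1 := sum_slice_dotProduct J (w α s) (w α s')
      simp only [h.dotProduct_slice_eq_zero, h.orthonormal, Finset.sum_const, Finset.card_univ,
        Fintype.card_fun, ZMod.card, Fintype.card_coe, nsmul_eq_mul, Nat.cast_pow] at h1
      rw [h.dotProduct_slice_eq_zero, h1]
      simp
    · rw [h.dotProduct_slice_of_ne_pair α s s' ht, mul_zero, if_neg fun h' => ht h'.1]
  · rw [h.dotProduct_slice_of_ne_ancilla hα, mul_zero, if_neg fun h' => hα h'.2.1]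

end EigenFrame

/-- The matrix whose columns are the normalized slices of the vectors `w α s`. -/
noncomputable def sliceMatrix (e : {j // j ∈ J} ⊕ (Fin ℓ ⊕ Fin k) ≃ {j // j ∉ J})
    (w : Basis p (Fin ℓ) → Basis p (Fin k) → Basis p N → ℂ) : Op p {j // j ∉ J} :=
  Matrix.of fun x y => (Real.sqrt ((p : ℝ) ^ J.card) : ℂ) *
    slice J (w (fun a => y (e (Sum.inr (Sum.inl a)))) (fun b => y (e (Sum.inr (Sum.inr b)))))
      (fun i => y (e (Sum.inl i))) x

namespace EigenFrame

variable {hω : IsPrimitiveRoot ω p} {γ : {j // j ∈ J} ⊕ ({j // j ∈ J} ⊕ Fin ℓ) → N ⊕ N → ZMod p}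
  {lam : {j // j ∈ J} ⊕ ({j // j ∈ J} ⊕ Fin ℓ) → ℂ}
  {w : Basis p (Fin ℓ) → Basis p (Fin k) → Basis p N → ℂ}

theorem sliceMatrix_mem_unitaryGroup (h : EigenFrame hω J γ lam w)
    (e : {j // j ∈ J} ⊕ (Fin ℓ ⊕ Fin k) ≃ {j // j ∉ J}) :
    sliceMatrix e w ∈ Matrix.unitaryGroup (Basis p {j // j ∉ J}) ℂ := by
  rw [Matrix.mem_unitaryGroup_iff']
  ext y y'
  have hs : star (Real.sqrt ((p : ℝ) ^ J.card) : ℂ) * (Real.sqrt ((p : ℝ) ^ J.card) : ℂ) =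
      (p : ℂ) ^ J.card := by
    rw [Complex.star_def, Complex.conj_ofReal, ← Complex.ofReal_mul,
      Real.mul_self_sqrt (by positivity)]
    simp
  have h1 := h.dotProduct_slice (fun a => y (e (Sum.inr (Sum.inl a))))
    (fun a => y' (e (Sum.inr (Sum.inl a)))) (fun b => y (e (Sum.inr (Sum.inr b))))
    (fun b => y' (e (Sum.inr (Sum.inr b)))) (fun i => y (e (Sum.inl i)))
    (fun i => y' (e (Sum.inl i)))
  rw [Matrix.one_apply, Matrix.mul_apply]
  refine Eq.trans ?_ (h1.trans (if_congr ?_ rfl rfl))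
  · rw [dotProduct, Finset.mul_sum]
    refine Finset.sum_congr rfl fun x _ => ?_
    rw [Matrix.star_apply, sliceMatrix, Matrix.of_apply, Matrix.of_apply, star_mul', ← hs,
      Pi.star_apply]
    ring
  · rw [show y = y' ↔ y = label e (fun i => y' (e (Sum.inl i)))
      (fun a => y' (e (Sum.inr (Sum.inl a)))) (fun b => y' (e (Sum.inr (Sum.inr b)))) by
        rw [← (eq_label_iff e _ _ _ y').2 ⟨fun _ => rfl, fun _ => rfl, fun _ => rfl⟩],
      eq_label_iff]
    simp only [funext_iff]

/-- This is an eigenvalue equation cut into slices. Here `u` is the one-qudit operator before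
conjugation: its shift matches that of `v` on `J`, and its phase together with that of the `J` part
makes up the eigenvalue, apart from `a`. -/
theorem weyl_mul_sliceMatrix (hω : IsPrimitiveRoot ω p)
    (e : {j // j ∈ J} ⊕ (Fin ℓ ⊕ Fin k) ≃ {j // j ∉ J}) {v : N ⊕ N → ZMod p}
    {u : {j // j ∉ J} ⊕ {j // j ∉ J} → ZMod p} {a : ℂ}
    (hx : ∀ i, inside J v (Sum.inl i) = u (Sum.inl (e (Sum.inl i))))
    (hx' : ∀ i, u (Sum.inl (e (Sum.inr i))) = 0)
    (hv : ∀ (y : Basis p {j // j ∉ J}),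
      weyl ω v *ᵥ w (fun a => y (e (Sum.inr (Sum.inl a)))) (fun b => y (e (Sum.inr (Sum.inr b)))) =
      (a * phase hω (∑ j, inside J v (Sum.inr j) * y (e (Sum.inl j)) + ∑ j, u (Sum.inr j) * y j)) •
        w (fun a => y (e (Sum.inr (Sum.inl a)))) (fun b => y (e (Sum.inr (Sum.inr b))))) :
    weyl ω (outside J v) * sliceMatrix e w = a • (sliceMatrix e w * weyl ω u) := by
  ext x y
  have h1 : (weyl ω (outside J v) * sliceMatrix e w) x y = (Real.sqrt ((p : ℝ) ^ J.card) : ℂ) *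
      (weyl ω (outside J v) *ᵥ slice J (w (fun a => y (e (Sum.inr (Sum.inl a))))
        (fun b => y (e (Sum.inr (Sum.inr b))))) (fun i => y (e (Sum.inl i)))) x := by
    rw [Matrix.mul_apply, Matrix.mulVec, dotProduct, Finset.mul_sum]
    refine Finset.sum_congr rfl fun z _ => ?_
    rw [sliceMatrix, Matrix.of_apply]
    ring
  have h2 : (sliceMatrix e w * weyl ω u) x y =
      sliceMatrix e w x (y + u ∘ Sum.inl) * phase hω (∑ j, u (Sum.inr j) * y j) := by
    simp only [Matrix.mul_apply, weyl_apply hω, mul_ite, mul_zero]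
    rw [Finset.sum_ite_eq', if_pos (Finset.mem_univ _)]
  have h3 := slice_weyl_mulVec hω J v (w (fun a => y (e (Sum.inr (Sum.inl a))))
        (fun b => y (e (Sum.inr (Sum.inr b))))) (fun i => (y + u ∘ Sum.inl) (e (Sum.inl i)))
  have h4 : (fun i => (y + u ∘ Sum.inl) (e (Sum.inl i))) - inside J v ∘ Sum.inl =
      fun i => y (e (Sum.inl i)) := by
    funext i
    simp [hx]
  have h5 : ∀ i, (y + u ∘ Sum.inl) (e (Sum.inr i)) = y (e (Sum.inr i)) := by
    intro i
    simp [hx']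
  have h6 : ∑ j, inside J v (Sum.inr j) * ((y + u ∘ Sum.inl) (e (Sum.inl j)) -
      inside J v (Sum.inl j)) = ∑ j, inside J v (Sum.inr j) * y (e (Sum.inl j)) := by
    refine Finset.sum_congr rfl fun j _ => ?_
    simp [hx]
  rw [hv, h4, h6, slice_smul] at h3
  have h7 := congrFun h3 x
  rw [Matrix.smul_apply, h1, h2, sliceMatrix, Matrix.of_apply]
  simp only [h5]
  simp only [Pi.smul_apply, smul_eq_mul, AddChar.map_add_eq_mul] at h7 ⊢
  have h8 := phase_ne_zero hω (∑ j, inside J v (Sum.inr j) * y (e (Sum.inl j)))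
  apply mul_left_cancel₀ h8
  linear_combination (-(Real.sqrt ((p : ℝ) ^ J.card) : ℂ)) * h7

theorem weyl_mul_sliceMatrix_x (h : EigenFrame hω J γ lam w)
    (e : {j // j ∈ J} ⊕ (Fin ℓ ⊕ Fin k) ≃ {j // j ∉ J}) (i : {j // j ∈ J}) :
    weyl ω (outside J (γ (Sum.inl i))) * sliceMatrix e w =
      lam (Sum.inl i) • (sliceMatrix e w * single (e (Sum.inl i)) (shift p ^ 1)) := by
  rw [single_shift ω]
  refine weyl_mul_sliceMatrix hω e (fun j => ?_) (fun j => ?_) fun y => ?_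
  · rw [h.inside_x]
    simp [Pi.single_apply]
  · simp
  · rw [h.inside_x, h.eigen_x]
    simp

theorem weyl_mul_sliceMatrix_z (h : EigenFrame hω J γ lam w)
    (e : {j // j ∈ J} ⊕ (Fin ℓ ⊕ Fin k) ≃ {j // j ∉ J}) (j : {j // j ∈ J} ⊕ Fin ℓ) :
    weyl ω (outside J (γ (Sum.inr j))) * sliceMatrix e w =
      lam (Sum.inr j) • (sliceMatrix e w * single (posZ J e j) (clock p ω)) := by
  rw [single_clock ω]
  rcases j with i | a
  · refine weyl_mul_sliceMatrix hω e (fun j => ?_) (fun j => ?_) fun y => ?_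
    · rw [h.inside_z]
      simp
    · simp
    · rw [h.inside_z, h.eigen_z]
      simp [posZ, Pi.single_apply]
  · refine weyl_mul_sliceMatrix hω e (fun j => ?_) (fun j => ?_) fun y => ?_
    · rw [h.inside_a]
      simp
    · simp
    · rw [h.inside_a, h.eigen_a]
      simp [posZ, Pi.single_apply]

/-- The encoder given by the slices of an eigenframe has the vectors `w 0 s` as its columns. -/
theorem encoder_sliceMatrix (h : EigenFrame hω J γ lam w)
    (e : {j // j ∈ J} ⊕ (Fin ℓ ⊕ Fin k) ≃ {j // j ∉ J}) (x : Basis p N) (s : Basis p (Fin k)) :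
    encoder J ⟨sliceMatrix e w, h.sliceMatrix_mem_unitaryGroup e⟩ e x s = w 0 s x := by
  have hp : (Real.sqrt ((p : ℝ) ^ J.card) : ℂ) ≠ 0 := by
    rw [Complex.ofReal_ne_zero, Real.sqrt_ne_zero']
    exact pow_pos (Nat.cast_pos.2 (Fact.out : p.Prime).pos) _
  rw [encoder_apply]
  change sliceMatrix e w _ _ * _ = _
  rw [sliceMatrix, Matrix.of_apply]
  have h1 : ∀ t : Basis p {j // j ∈ J}, (fun i => label e t 0 s (e (Sum.inl i))) = t := by
    intro t; funext i; simp [label]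
  have h2 : ∀ t : Basis p {j // j ∈ J},
      (fun i => label e t 0 s (e (Sum.inr (Sum.inl i)))) = 0 := by
    intro t; funext i; simp [label]
  have h3 : ∀ t : Basis p {j // j ∈ J},
      (fun i => label e t 0 s (e (Sum.inr (Sum.inr i)))) = s := by
    intro t; funext i; simp [label]
  rw [h1, h2, h3, slice, glue_restrict]
  field_simp

end EigenFrame

end Encoders

end QSS

namespace QSS

/-! ### Channels and erasure correction -/

section Channels

attribute [local instance 2000] Matrix.instHMulOfFintypeOfMulOfAddCommMonoid

theorem isChannel_of_kraus {A B ι : Type} [Fintype A] [DecidableEq A] [Fintype B] [Fintype ι]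
    {Φ : Matrix A A ℂ → Matrix B B ℂ} (K : ι → Matrix B A ℂ) (hK : ∑ i, (K i)ᴴ * K i = 1)
    (hΦ : ∀ ρ, Φ ρ = ∑ i, K i * ρ * (K i)ᴴ) : IsChannel Φ := by
  let E := Fintype.equivFin ι
  refine ⟨Fintype.card ι, fun i => K (E.symm i), ?_, fun ρ => ?_⟩
  · rw [← hK]
    exact E.symm.sum_comp fun i => (K i)ᴴ * K i
  · rw [hΦ]
    exact (E.symm.sum_comp fun i => K i * ρ * (K i)ᴴ).symm

theorem IsChannel.comp {A B C : Type} [Fintype A] [DecidableEq A] [Fintype B] [DecidableEq B]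
    [Fintype C] {Φ : Matrix A A ℂ → Matrix B B ℂ} {Ψ : Matrix B B ℂ → Matrix C C ℂ}
    (hΨ : IsChannel Ψ) (hΦ : IsChannel Φ) : IsChannel (Ψ ∘ Φ) := by
  obtain ⟨m, K, hK, hΦ⟩ := hΦ
  obtain ⟨m', L, hL, hΨ⟩ := hΨ
  replace hK : ∑ i, (K i)ᴴ * K i = 1 := hK
  replace hL : ∑ i, (L i)ᴴ * L i = 1 := hL
  replace hΦ : ∀ ρ, Φ ρ = ∑ i, K i * ρ * (K i)ᴴ := hΦ
  replace hΨ : ∀ ρ, Ψ ρ = ∑ i, L i * ρ * (L i)ᴴ := hΨ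
  refine isChannel_of_kraus (fun z : Fin m × Fin m' => L z.2 * K z.1) ?_ fun ρ => ?_
  · rw [Fintype.sum_prod_type]
    have : ∀ i, ∑ j, (L j * K i)ᴴ * (L j * K i) = (K i)ᴴ * K i := by
      intro i
      have h : ∀ j, (L j * K i)ᴴ * (L j * K i) = (K i)ᴴ * ((L j)ᴴ * L j) * K i := by
        intro j
        rw [Matrix.conjTranspose_mul]
        simp only [Matrix.mul_assoc]
      simp only [h]
      rw [← Matrix.sum_mul, ← Matrix.mul_sum, hL, Matrix.mul_one]
    simp only [this, hK]
  · rw [Function.comp_apply, hΨ, hΦ, Fintype.sum_prod_type_right]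
    refine Finset.sum_congr rfl fun j _ => ?_
    rw [Matrix.mul_sum, Matrix.sum_mul]
    refine Finset.sum_congr rfl fun i _ => ?_
    rw [Matrix.conjTranspose_mul]
    simp only [Matrix.mul_assoc]

theorem isChannel_isometry {A B : Type} [Fintype A] [DecidableEq A] [Fintype B]
    {V : Matrix B A ℂ} (hV : Vᴴ * V = 1) : IsChannel fun ρ : Matrix A A ℂ => (V * ρ * Vᴴ : Matrix B B ℂ) :=
  isChannel_of_kraus (fun _ : Unit => V) (by simpa using hV) fun ρ => by simp

theorem pureState_mulVec {A B : Type} [Fintype A] [Fintype B] (M : Matrix B A ℂ) (v : A → ℂ) :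
    M * pureState v * Mᴴ = pureState (M *ᵥ v) := by
  rw [pureState, pureState, Matrix.mul_vecMulVec, Matrix.vecMulVec_mul, Matrix.star_mulVec]

/-- An isometric encoding can be undone by a channel. -/
theorem exists_channel_inverse {A B : Type} [Fintype A] [DecidableEq A] [Nonempty A] [Fintype B]
    [DecidableEq B] {V : Matrix B A ℂ} (hV : Vᴴ * V = 1) :
    ∃ Ψ : Matrix B B ℂ → Matrix A A ℂ, IsChannel Ψ ∧
      ∀ ψ, Ψ (pureState (V *ᵥ ψ)) = pureState ψ := by
  obtain ⟨a⟩ := ‹Nonempty A›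
  let R : Matrix B B ℂ := 1 - V * Vᴴ
  -- `Vᴴ` decodes the range of `V`. The other operators send its orthogonal complement to the fixed
  -- basis state `a`; they vanish on codewords and serve only to preserve the trace.
  let K : Option B → Matrix A B ℂ := fun o => o.elim Vᴴ fun b => Matrix.single a b (1 : ℂ) * R
  have hRV : R * V = 0 := by
    simp only [R]
    rw [Matrix.sub_mul, Matrix.mul_assoc, hV]
    simp
  have hRR : Rᴴ * R = R := by
    have : Rᴴ = R := by simp [R]
    rw [this]
    nth_rw 2 [show R = 1 - V * Vᴴ from rfl]
    rw [Matrix.mul_sub, ← Matrix.mul_assoc, hRV]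
    simp
  refine ⟨fun ρ => ∑ o, K o * ρ * (K o)ᴴ, isChannel_of_kraus K ?_ fun ρ => rfl, fun ψ => ?_⟩
  · rw [Fintype.sum_option]
    have h : ∀ b, (K (some b))ᴴ * K (some b) = Rᴴ * Matrix.single b b 1 * R := by
      intro b
      simp only [K, Option.elim, Matrix.conjTranspose_mul, Matrix.conjTranspose_single, star_one]
      rw [Matrix.mul_assoc, ← Matrix.mul_assoc (Matrix.single b a 1), Matrix.single_mul_single_same,
        mul_one, ← Matrix.mul_assoc]
    simp only [h]
    rw [← Matrix.sum_mul, ← Matrix.mul_sum, Matrix.sum_single_one, Matrix.mul_one, hRR]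
    simp [K, R]
  · have h : ∀ b, K (some b) *ᵥ (V *ᵥ ψ) = 0 := by
      intro b
      simp only [K, Option.elim]
      rw [Matrix.mulVec_mulVec, Matrix.mul_assoc, hRV, Matrix.mul_zero, Matrix.zero_mulVec]
    simp only [pureState_mulVec]
    rw [Fintype.sum_option]
    simp only [h]
    have h0 : pureState (0 : A → ℂ) = 0 := by
      rw [pureState, star_zero, Matrix.vecMulVec_zero]
    rw [h0, Finset.sum_const_zero, add_zero]
    simp only [K, Option.elim]
    rw [Matrix.mulVec_mulVec, hV, Matrix.one_mulVec]

/-- The information of an isometric encoder can be restored after an erasure if and only if the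
states of its range can be restored. -/
theorem encoderCorrects_iff_codeCorrects {p : ℕ} [Fact p.Prime] {N : Type} [Fintype N]
    [DecidableEq N] {k : ℕ} {V : Matrix (Basis p N) (Basis p (Fin k)) ℂ} (hV : Vᴴ * V = 1)
    (T : Finset N) :
    EncoderCorrects V T ↔ CodeCorrects (LinearMap.range V.mulVecLin) T := by
  constructor
  · rintro ⟨Φ, hΦ, h⟩
    refine ⟨_, (isChannel_isometry hV).comp hΦ, ?_⟩
    rintro _ ⟨ψ, rfl⟩
    rw [Function.comp_apply, Matrix.mulVecLin_apply, h, pureState_mulVec]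
  · rintro ⟨Φ, hΦ, h⟩
    obtain ⟨Ψ, hΨ, hΨV⟩ := exists_channel_inverse hV
    refine ⟨_, hΨ.comp hΦ, fun ψ => ?_⟩
    rw [Function.comp_apply, ← Matrix.mulVecLin_apply, h _ ⟨ψ, rfl⟩,
      Matrix.mulVecLin_apply, hΨV]

end Channels

end QSS

namespace QSS

/-! ### Eigenvalues, adapted bases and eigenframes of a stabilizer -/

section Stabilizers

attribute [local instance 2000] Matrix.instHMulOfFintypeOfMulOfAddCommMonoid

variable {p : ℕ} [Fact p.Prime] {N : Type} [Fintype N] [DecidableEq N] {ω : ℂ}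

/-- A stabilizer code is the simultaneous eigenspace of the Pauli operators of `f(S)`. -/
theorem IsStabilizerCode.exists_eigenvalues (hω : IsPrimitiveRoot ω p)
    {S : Subgroup (UnitaryOp p N)} (hS : IsStabilizer ω S) {Q : Submodule ℂ (Basis p N → ℂ)}
    (hQ : IsStabilizerCode S Q) :
    ∃ lam : (N ⊕ N → ZMod p) → ℂ, ∀ w, w ∈ Q ↔
      ∀ v ∈ symplecticImage ω S, weyl ω v *ᵥ w = lam v • w := by
  classical
  obtain ⟨hQ0, ev, hev⟩ := hQ
  obtain ⟨w₀, hw₀Q, hw₀⟩ := Q.ne_bot_iff.1 hQ0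
  have hω0 : ω ≠ 0 := hω.ne_zero (Fact.out : p.Prime).ne_zero
  have hex : ∀ v ∈ symplecticImage ω S, ∃ a : ℂ, ∀ w ∈ Q, weyl ω v *ᵥ w = a • w := by
    rintro v ⟨M, hM, i, hMv⟩
    replace hMv : (M : Op p N) = ω ^ i • weyl ω v := hMv
    refine ⟨(ω ^ i)⁻¹ * ev M, fun w hw => ?_⟩
    have h := (hev w).1 hw M hM
    rw [hMv, Matrix.smul_mulVec] at h
    rw [mul_smul, ← h, smul_smul, inv_mul_cancel₀ (pow_ne_zero _ hω0), one_smul]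
  choose! lam hlam using hex
  refine ⟨lam, fun w => ⟨fun hw v hv => hlam v hv w hw, fun h => (hev w).2 fun M hM => ?_⟩⟩
  obtain ⟨c, v, hMv⟩ := (mem_errorGroup_iff hω).1 (hS.1 hM)
  have hv : v ∈ symplecticImage ω S :=
    ⟨M, hM, c.val, by rw [hMv, phase_apply]; rfl⟩
  -- The nonzero vector `w₀` identifies `ev M` with the phase of `M` times `lam v`.
  have h0 := (hev w₀).1 hw₀Q M hM
  rw [hMv, Matrix.smul_mulVec, hlam v hv w₀ hw₀Q, smul_smul] at h0
  rw [hMv, Matrix.smul_mulVec, h v hv, smul_smul, ← smul_left_injective ℂ hw₀ h0]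

/-- Vectors whose Pauli operators have a common eigenvector are orthogonal. -/
theorem symp_eq_zero_of_eigenvector (hω : IsPrimitiveRoot ω p) {u v : N ⊕ N → ZMod p}
    {w : Basis p N → ℂ} {a b : ℂ} (hw : w ≠ 0) (hu : weyl ω u *ᵥ w = a • w)
    (hv : weyl ω v *ᵥ w = b • w) : symp u v = 0 := by
  have h := congrArg (fun M : Op p N => M *ᵥ w) (weyl_mul_comm hω u v)
  simp only [← Matrix.mulVec_mulVec, Matrix.smul_mulVec, hu, hv, Matrix.mulVec_smul,
    smul_smul] at h
  have h1 := smul_left_injective ℂ hw h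
  have ha := ne_zero_of_eigenvector hω hw hu
  have hb := ne_zero_of_eigenvector hω hw hv
  rw [← phase_eq_one_iff hω]
  apply mul_right_cancel₀ (mul_ne_zero ha hb)
  linear_combination -h1

theorem symp_sum_smul_left {ι : Type} [Fintype ι] (t : ι → ZMod p) (u : ι → N ⊕ N → ZMod p)
    (v : N ⊕ N → ZMod p) : symp (∑ i, t i • u i) v = ∑ i, t i * symp (u i) v := by
  simp only [symp, Finset.sum_apply, Pi.smul_apply, smul_eq_mul, Finset.mul_sum, Finset.sum_mul]
  rw [Finset.sum_comm]
  refine Finset.sum_congr rfl fun j _ => ?_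
  rw [← Finset.sum_sub_distrib]
  exact Finset.sum_congr rfl fun i _ => by ring

/-- The symplectic products with linearly independent vectors can be prescribed. -/
theorem exists_symp_eq {ι : Type} {γ : ι → N ⊕ N → ZMod p} (hγ : LinearIndependent (ZMod p) γ)
    (c : ι → ZMod p) : ∃ κ : N ⊕ N → ZMod p, ∀ g, symp (γ g) κ = c g := by
  let b := Module.Basis.sumExtend hγ
  let f : (N ⊕ N → ZMod p) →ₗ[ZMod p] ZMod p := b.constr (ZMod p) (Sum.elim c 0)
  have hf : ∀ g, f (γ g) = c g := by
    intro g
    have h1 : b (Sum.inl g) = γ g := by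
      simp [b, Module.Basis.sumExtend]
      rfl
    rw [← h1, Module.Basis.constr_basis, Sum.elim_inl]
  -- Nondegeneracy of the symplectic form: swapping the halves with a sign turns the functional `f`
  -- into a product with `κ`.
  refine ⟨Sum.elim (fun j => f (Pi.single (Sum.inr j) 1)) (fun j => -f (Pi.single (Sum.inl j) 1)),
    fun g => ?_⟩
  rw [← hf g, LinearMap.pi_apply_eq_sum_univ f (γ g), Fintype.sum_sum_type, symp,
    ← Finset.sum_add_distrib]
  have h2 : ∀ i : N ⊕ N, (fun j => if i = j then (1 : ZMod p) else 0) = Pi.single i 1 := by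
    intro i
    funext j
    simp [Pi.single_apply, eq_comm]
  refine Finset.sum_congr rfl fun j _ => ?_
  simp only [h2, Sum.elim_inl, Sum.elim_inr, smul_eq_mul]
  ring

/-- Vectors that restrict to a basis of `(a|b)` on `J` extend to a basis by vectors that vanish
on `J`. -/
theorem exists_adapted_basis (J : Finset N) (F : Submodule (ZMod p) (N ⊕ N → ZMod p))
    {ρ σ : {j // j ∈ J} → N ⊕ N → ZMod p} (hρF : ∀ i, ρ i ∈ F) (hσF : ∀ i, σ i ∈ F)
    (hρ : ∀ i, inside J (ρ i) = Sum.elim (Pi.single i 1) (0 : {j // j ∈ J} → ZMod p))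
    (hσ : ∀ i, inside J (σ i) = Sum.elim (0 : {j // j ∈ J} → ZMod p) (Pi.single i (-1))) :
    ∃ (ℓ : ℕ) (τ : Fin ℓ → N ⊕ N → ZMod p), (∀ a, inside J (τ a) = 0) ∧
      LinearIndependent (ZMod p) (Sum.elim ρ (Sum.elim σ τ)) ∧
      Submodule.span (ZMod p) (Set.range (Sum.elim ρ (Sum.elim σ τ))) = F := by
  have hρl : ∀ i j : {j // j ∈ J}, ρ i (Sum.inl j.1) = if j = i then 1 else 0 := fun i j =>
    (congrFun (hρ i) (Sum.inl j)).trans (by simp [Pi.single_apply])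
  have hρr : ∀ i j : {j // j ∈ J}, ρ i (Sum.inr j.1) = 0 := fun i j =>
    (congrFun (hρ i) (Sum.inr j)).trans (by simp)
  have hσl : ∀ i j : {j // j ∈ J}, σ i (Sum.inl j.1) = 0 := fun i j =>
    (congrFun (hσ i) (Sum.inl j)).trans (by simp)
  have hσr : ∀ i j : {j // j ∈ J}, σ i (Sum.inr j.1) = if j = i then -1 else 0 := fun i j =>
    (congrFun (hσ i) (Sum.inr j)).trans (by simp [Pi.single_apply])
  let K : Submodule (ZMod p) (N ⊕ N → ZMod p) := F ⊓ LinearMap.ker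
    (LinearMap.funLeft (ZMod p) (ZMod p)
      (Sum.map Subtype.val Subtype.val : {j // j ∈ J} ⊕ {j // j ∈ J} → N ⊕ N))
  have hK : ∀ v, v ∈ K ↔ v ∈ F ∧ inside J v = 0 := fun v => Iff.rfl
  let τ := Module.finBasis (ZMod p) K
  have hτ0 : ∀ a, inside J (τ a : N ⊕ N → ZMod p) = 0 := fun a => ((hK _).1 (τ a).2).2
  have hτl : ∀ a (j : {j // j ∈ J}), (τ a : N ⊕ N → ZMod p) (Sum.inl j.1) = 0 := fun a j =>
    congrFun (hτ0 a) (Sum.inl j)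
  have hτr : ∀ a (j : {j // j ∈ J}), (τ a : N ⊕ N → ZMod p) (Sum.inr j.1) = 0 := fun a j =>
    congrFun (hτ0 a) (Sum.inr j)
  refine ⟨_, fun a => (τ a : N ⊕ N → ZMod p), hτ0, ?_, le_antisymm ?_ ?_⟩
  · rw [Fintype.linearIndependent_iff]
    intro g hg
    simp only [Fintype.sum_sum_type, Sum.elim_inl, Sum.elim_inr] at hg
    have h1 : ∀ i, g (Sum.inl i) = 0 := fun i => by
      simpa [hρl, hσl, hτl] using congrFun hg (Sum.inl i.1)
    have h2 : ∀ i, g (Sum.inr (Sum.inl i)) = 0 := fun i => by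
      simpa [hρr, hσr, hτr] using congrFun hg (Sum.inr i.1)
    have h3 : LinearIndependent (ZMod p) fun a => (τ a : N ⊕ N → ZMod p) :=
      τ.linearIndependent.map' K.subtype (Submodule.ker_subtype K)
    simp only [h1, h2, zero_smul, Finset.sum_const_zero, zero_add] at hg
    have h4 := Fintype.linearIndependent_iff.1 h3 _ hg
    rintro (i | i | i)
    exacts [h1 i, h2 i, h4 i]
  · rw [Submodule.span_le]
    rintro _ ⟨i | i | i, rfl⟩
    exacts [hρF i, hσF i, ((hK _).1 (τ i).2).1]
  · intro v hv
    set G := Submodule.span (ZMod p) (Set.range (Sum.elim ρ (Sum.elim σ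
      fun a => (τ a : N ⊕ N → ZMod p)))) with hG
    have hmem : ∀ g, Sum.elim ρ (Sum.elim σ fun a => (τ a : N ⊕ N → ZMod p)) g ∈ G :=
      fun g => Submodule.subset_span ⟨g, rfl⟩
    -- This combination agrees with `v` on `J`; the minus sign compensates the `-1` in `σ`.
    let u := ∑ i : {j // j ∈ J}, v (Sum.inl i.1) • ρ i - ∑ i : {j // j ∈ J}, v (Sum.inr i.1) • σ i
    have huF : u ∈ F := F.sub_mem (F.sum_mem fun i _ => F.smul_mem _ (hρF i))
      (F.sum_mem fun i _ => F.smul_mem _ (hσF i))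
    have huG : u ∈ G := G.sub_mem (G.sum_mem fun i _ => G.smul_mem _ (hmem (Sum.inl i)))
      (G.sum_mem fun i _ => G.smul_mem _ (hmem (Sum.inr (Sum.inl i))))
    have hvu : v - u ∈ K := by
      refine (hK _).2 ⟨F.sub_mem hv huF, ?_⟩
      funext j
      rcases j with j | j
      · simp [inside, u, hρl, hσl]
      · simp [inside, u, hρr, hσr]
    have hKG : v - u ∈ G := by
      have h := congrArg Subtype.val (τ.sum_repr ⟨v - u, hvu⟩)
      rw [← show _ = v - u from h, Submodule.coe_sum]
      exact G.sum_mem fun a _ => G.smul_mem _ (hmem (Sum.inr (Sum.inr a)))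
    rw [← sub_add_cancel v u]
    exact G.add_mem hKG huG

theorem exists_orthonormal_basis {A B : Type} [Fintype A] [Fintype B] [DecidableEq B]
    (Q : Submodule ℂ (A → ℂ)) (hQ : Module.finrank ℂ Q = Fintype.card B) :
    ∃ w : B → A → ℂ, (∀ b, w b ∈ Q) ∧
      ∀ b b', star (w b) ⬝ᵥ w b' = if b = b' then 1 else 0 := by
  let L : EuclideanSpace ℂ A ≃ₗ[ℂ] (A → ℂ) := WithLp.linearEquiv 2 ℂ (A → ℂ)
  let Q' : Submodule ℂ (EuclideanSpace ℂ A) := Q.map (L.symm : (A → ℂ) →ₗ[ℂ] EuclideanSpace ℂ A)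
  have hQ' : Module.finrank ℂ Q' = Fintype.card B := by
    rw [← hQ]
    exact LinearEquiv.finrank_map_eq L.symm Q
  let o := (stdOrthonormalBasis ℂ Q').reindex ((finCongr hQ').trans (Fintype.equivFin B).symm)
  refine ⟨fun b => L (o b), fun b => ?_, fun b b' => ?_⟩
  · obtain ⟨x, hx, hxo⟩ := (o b).2
    simpa [← hxo] using hx
  · have h := orthonormal_iff_ite.1 o.orthonormal b b'
    rw [← h, Submodule.coe_inner, EuclideanSpace.inner_eq_star_dotProduct, dotProduct_comm]
    rfl

/-- A subgroup of the error group is generated by its scalars and any elements whose vectors span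
`f(S)`. -/
theorem eq_closure_union_scalars (hω : IsPrimitiveRoot ω p) {S : Subgroup (UnitaryOp p N)}
    (hS : (S : Set (UnitaryOp p N)) ⊆ errorGroup ω N) {A : Set (UnitaryOp p N)}
    (hA : A ⊆ S) {ι : Type} {γ : ι → N ⊕ N → ZMod p}
    (hγ : ∀ g, ∃ M ∈ A, ∃ c : ℂ, (M : Op p N) = c • weyl ω (γ g))
    (hspan : symplecticImage ω S ⊆ Submodule.span (ZMod p) (Set.range γ)) :
    S = Subgroup.closure (A ∪ {M | M ∈ S ∧ ∃ c : ℂ, (M : Op p N) = c • (1 : Op p N)}) := by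
  have hAS : Subgroup.closure A ≤ S := (Subgroup.closure_le S).2 hA
  let add : AddSubmonoid (N ⊕ N → ZMod p) :=
    { carrier := {v | ∃ M ∈ Subgroup.closure A, ∃ c : ℂ, (M : Op p N) = c • weyl ω v}
      zero_mem' := ⟨1, one_mem _, 1, by rw [weyl_zero hω, one_smul]; rfl⟩
      add_mem' := by
        rintro u v ⟨M, hM, c, hMc⟩ ⟨M', hM', c', hMc'⟩
        refine ⟨M * M', mul_mem hM hM',
          c * c' * phase hω (∑ j, u (Sum.inr j) * v (Sum.inl j)), ?_⟩
        rw [Submonoid.coe_mul, hMc, hMc', smul_mul_smul_comm, mul_smul (c * c'), ← weyl_mul hω] }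
  -- Over `ZMod p` scalar multiplication is repeated addition, so closure under products already
  -- gives a subspace.
  let G : Submodule (ZMod p) (N ⊕ N → ZMod p) :=
    { add with
      smul_mem' := fun a v hv => by
        have h : a • v = a.val • v := by
          rw [← Nat.cast_smul_eq_nsmul (ZMod p), ZMod.natCast_zmod_val]
        rw [h]
        exact add.nsmul_mem hv _ }
  have hG : Submodule.span (ZMod p) (Set.range γ) ≤ G := by
    rw [Submodule.span_le]
    rintro _ ⟨g, rfl⟩
    obtain ⟨M, hM, c, hMc⟩ := hγ g
    exact ⟨M, Subgroup.subset_closure hM, c, hMc⟩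
  refine le_antisymm (fun M hM => ?_) ((Subgroup.closure_le S).2 ?_)
  · obtain ⟨c, v, hMv⟩ := (mem_errorGroup_iff hω).1 (hS hM)
    obtain ⟨M', hM', c', hMv'⟩ :=
      hG (hspan (show v ∈ symplecticImage ω S from
        ⟨M, hM, c.val, by rw [hMv, phase_apply]; rfl⟩))
    have hc' : c' ≠ 0 := by
      rintro rfl
      have h1 : (star (M' : Op p N)) * (M' : Op p N) = 1 := Matrix.mem_unitaryGroup_iff'.1 M'.2
      rw [hMv', zero_smul, mul_zero] at h1
      exact zero_ne_one h1
    -- Both elements have the same vector, so `M * M'⁻¹` is a scalar, and it lies in `S`.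
    have hMM' : (M : Op p N) = (phase hω c * c'⁻¹) • (M' : Op p N) := by
      rw [hMv, hMv', smul_smul, mul_assoc, inv_mul_cancel₀ hc', mul_one]
    have hscal : ((M * M'⁻¹ : UnitaryOp p N) : Op p N) = (phase hω c * c'⁻¹) • (1 : Op p N) := by
      rw [Submonoid.coe_mul, hMM', smul_mul_assoc, ← Submonoid.coe_mul, mul_inv_cancel]
      rfl
    rw [← inv_mul_cancel_right M M']
    exact mul_mem (Subgroup.subset_closure (Or.inr ⟨mul_mem hM (inv_mem (hAS hM')), _, hscal⟩))
      (Subgroup.closure_mono Set.subset_union_left hM')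
  · rintro M (hM | hM)
    exacts [hA hM, hM.1]

/-- The eigenframe of a simultaneous eigenspace. -/
theorem exists_eigenFrame (hω : IsPrimitiveRoot ω p) (J : Finset N) {ℓ k : ℕ}
    {γ : {j // j ∈ J} ⊕ ({j // j ∈ J} ⊕ Fin ℓ) → N ⊕ N → ZMod p}
    (hγ : LinearIndependent (ZMod p) γ)
    (hx : ∀ i, inside J (γ (Sum.inl i)) =
      Sum.elim (Pi.single i 1) (0 : {j // j ∈ J} → ZMod p))
    (hz : ∀ i, inside J (γ (Sum.inr (Sum.inl i))) =
      Sum.elim (0 : {j // j ∈ J} → ZMod p) (Pi.single i (-1)))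
    (ha : ∀ a, inside J (γ (Sum.inr (Sum.inr a))) = 0)
    {lam : (N ⊕ N → ZMod p) → ℂ} {Q : Submodule ℂ (Basis p N → ℂ)}
    (hQ : ∀ w ∈ Q, ∀ v ∈ Submodule.span (ZMod p) (Set.range γ), weyl ω v *ᵥ w = lam v • w)
    (hk : Module.finrank ℂ Q = p ^ k) :
    ∃ w : Basis p (Fin ℓ) → Basis p (Fin k) → Basis p N → ℂ, (∀ s, w 0 s ∈ Q) ∧
      EigenFrame hω J γ (fun g => lam (γ g)) w := by
  obtain ⟨w₀, hw₀Q, hw₀⟩ := exists_orthonormal_basis (B := Basis p (Fin k)) Q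
    (by rw [hk, Fintype.card_fun, ZMod.card, Fintype.card_fin])
  have hne : w₀ 0 ≠ 0 := by
    intro h
    have := hw₀ 0 0
    rw [h, dotProduct_zero, if_pos rfl] at this
    exact zero_ne_one this
  -- Translation by `κ α` alters only the ancilla eigenvalues. Choosing `κ 0 = 0` keeps the vectors
  -- `w 0 s` in `Q`.
  have hκ : ∀ α : Basis p (Fin ℓ), ∃ κ : N ⊕ N → ZMod p,
      (∀ g, symp (γ g) κ =
        Sum.elim (0 : {j // j ∈ J} → ZMod p) (Sum.elim (0 : {j // j ∈ J} → ZMod p) α) g) ∧ (α = 0 → κ = 0) := by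
    intro α
    by_cases hα : α = 0
    · subst hα
      exact ⟨0, fun g => by rcases g with g | g | g <;> simp [symp], fun _ => rfl⟩
    · obtain ⟨κ, h⟩ := exists_symp_eq hγ (Sum.elim (0 : {j // j ∈ J} → ZMod p) (Sum.elim (0 : {j // j ∈ J} → ZMod p) α))
      exact ⟨κ, h, fun h' => absurd h' hα⟩
  choose κ hκ hκ0 using hκ
  have heig : ∀ v ∈ Submodule.span (ZMod p) (Set.range γ), ∀ α s,
      weyl ω v *ᵥ (weyl ω (κ α) *ᵥ w₀ s) =
        (lam v * phase hω (symp v (κ α))) • weyl ω (κ α) *ᵥ w₀ s := by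
    intro v hv α s
    rw [Matrix.mulVec_mulVec, weyl_mul_comm hω, Matrix.smul_mulVec, ← Matrix.mulVec_mulVec,
      hQ _ (hw₀Q s) v hv, Matrix.mulVec_smul, smul_smul, mul_comm]
  have hspan : ∀ g, γ g ∈ Submodule.span (ZMod p) (Set.range γ) :=
    fun g => Submodule.subset_span ⟨g, rfl⟩
  have hnorm : ∀ v ∈ Submodule.span (ZMod p) (Set.range γ), star (lam v) * lam v = 1 :=
    fun v hv => star_mul_self_of_eigenvector hω hne (hQ _ (hw₀Q 0) v hv)
  refine ⟨fun α s => weyl ω (κ α) *ᵥ w₀ s, fun s => ?_, hx, hz, ha, fun g => hnorm _ (hspan g),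
    fun i α s => ?_, fun i α s => ?_, fun a α s => ?_, fun t => ?_, fun α s s' => ?_⟩
  · simpa [hκ0 0 rfl, weyl_zero hω] using hw₀Q s
  · simpa [hκ] using heig _ (hspan (Sum.inl i)) α s
  · simpa [hκ] using heig _ (hspan (Sum.inr (Sum.inl i))) α s
  · simpa [hκ] using heig _ (hspan (Sum.inr (Sum.inr a))) α s
  · have ht : ∑ i, t i • γ (Sum.inl i) ∈ Submodule.span (ZMod p) (Set.range γ) :=
      Submodule.sum_mem _ fun i _ => Submodule.smul_mem _ _ (hspan _)
    refine ⟨_, hnorm _ ht, fun α s => ?_⟩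
    rw [heig _ ht, symp_sum_smul_left]
    simp [hκ]
  · rw [star_mulVec_dotProduct_mulVec (weyl_conjTranspose_mul_self hω _), hw₀]

/-- The rows of a check matrix selected by the conditions on `J`. -/
theorem SatisfiesConditions.exists_rows {R : Type} [DecidableEq R]
    {H : Matrix R (N ⊕ N) (ZMod p)} {J : Finset N} (h : SatisfiesConditions H J) :
    ∃ ρ σ : {j // j ∈ J} → N ⊕ N → ZMod p,
      (∀ i, ρ i ∈ Submodule.span (ZMod p) (Set.range fun i => H i)) ∧
      (∀ i, σ i ∈ Submodule.span (ZMod p) (Set.range fun i => H i)) ∧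
      (∀ i, inside J (ρ i) = Sum.elim (Pi.single i 1) (0 : {j // j ∈ J} → ZMod p)) ∧
      ∀ i, inside J (σ i) = Sum.elim (0 : {j // j ∈ J} → ZMod p) (Pi.single i (-1)) := by
  obtain ⟨r, s, hinj, hr, hs⟩ := h
  have hrr : ∀ i j, r i = r j ↔ j = i := fun i j =>
    ⟨fun h => (Sum.inl_injective (hinj (a₁ := Sum.inl i) (a₂ := Sum.inl j) h)).symm,
      fun h => by rw [h]⟩
  have hss : ∀ i j, s i = s j ↔ j = i := fun i j =>
    ⟨fun h => (Sum.inr_injective (hinj (a₁ := Sum.inr i) (a₂ := Sum.inr j) h)).symm,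
      fun h => by rw [h]⟩
  have hrs : ∀ i j, r i ≠ s j := fun i j h =>
    Sum.inl_ne_inr (hinj (a₁ := Sum.inl i) (a₂ := Sum.inr j) h)
  -- The sign turns `Z` on the receiver's qudit into the required `Z⁻¹`.
  refine ⟨fun i => H (r i), fun i => -H (s i), fun i => Submodule.subset_span ⟨r i, rfl⟩,
    fun i => Submodule.neg_mem _ (Submodule.subset_span ⟨s i, rfl⟩), fun i => ?_, fun i => ?_⟩
  · funext j
    rcases j with j | j
    · simp [inside, hr, hrr, Pi.single_apply]
    · simp [inside, hs, hrs]
  · funext j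
    rcases j with j | j
    · simp [inside, hr, (hrs _ _).symm]
    · by_cases h : j = i <;> simp [inside, hs, hss, h]

end Stabilizers

end QSS

namespace QSS

/-! ### Pauli unitaries and assembly of the entanglement-assisted code -/

section Main

attribute [local instance 2000] Matrix.instHMulOfFintypeOfMulOfAddCommMonoid

variable {p : ℕ} [Fact p.Prime] {N : Type} [Fintype N] [DecidableEq N] {ω : ℂ}

/-- A multiple of a Pauli operator by a power of `ω`, as a unitary matrix. -/
noncomputable def phaseWeyl (hω : IsPrimitiveRoot ω p) (c : ZMod p) (v : N ⊕ N → ZMod p) :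
    UnitaryOp p N :=
  ⟨phase hω c • weyl ω v, by
    rw [Matrix.mem_unitaryGroup_iff']
    change (phase hω c • weyl ω v)ᴴ * (phase hω c • weyl ω v) = 1
    rw [Matrix.conjTranspose_smul, smul_mul_smul_comm, star_phase_mul_self, one_smul,
      weyl_conjTranspose_mul_self hω]⟩

theorem coe_phaseWeyl (hω : IsPrimitiveRoot ω p) (c : ZMod p) (v : N ⊕ N → ZMod p) :
    (phaseWeyl hω c v : Op p N) = phase hω c • weyl ω v := rfl

theorem phaseWeyl_mul_comm (hω : IsPrimitiveRoot ω p) (c c' : ZMod p) (u v : N ⊕ N → ZMod p) :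
    (phaseWeyl hω c u : Op p N) * (phaseWeyl hω c' v : Op p N) =
      phase hω (symp u v) • ((phaseWeyl hω c' v : Op p N) * (phaseWeyl hω c u : Op p N)) := by
  rw [coe_phaseWeyl, coe_phaseWeyl, smul_mul_smul_comm, weyl_mul_comm hω, smul_mul_smul_comm,
    smul_comm, mul_comm (phase hω c)]

theorem phaseWeyl_commute (hω : IsPrimitiveRoot ω p) (c c' : ZMod p) {u v : N ⊕ N → ZMod p}
    (h : symp u v = 0) :
    phaseWeyl hω c u * phaseWeyl hω c' v = phaseWeyl hω c' v * phaseWeyl hω c u := by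
  apply Subtype.ext
  have := phaseWeyl_mul_comm hω c c' u v
  rw [h, AddChar.map_zero_eq_one, one_smul] at this
  exact this

theorem phaseWeyl_ne (hω : IsPrimitiveRoot ω p) (c c' : ZMod p) {u v : N ⊕ N → ZMod p}
    (h : symp u v ≠ 0) :
    phaseWeyl hω c u * phaseWeyl hω c' v ≠ phaseWeyl hω c' v * phaseWeyl hω c u := by
  intro hc
  have h1 := phaseWeyl_mul_comm hω c c' u v
  have h2 : (phaseWeyl hω c u : Op p N) * (phaseWeyl hω c' v : Op p N) =
    (phaseWeyl hω c' v : Op p N) * (phaseWeyl hω c u : Op p N) := congrArg Subtype.val hc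
  rw [h2] at h1
  have h3 : (phaseWeyl hω c' v : Op p N) * (phaseWeyl hω c u : Op p N) ≠ 0 := by
    intro h0
    have h4 := Matrix.mem_unitaryGroup_iff'.1 (phaseWeyl hω c' v * phaseWeyl hω c u).2
    rw [Submonoid.coe_mul, h0, mul_zero] at h4
    exact zero_ne_one h4
  apply h
  rw [← phase_eq_one_iff hω]
  exact (smul_left_injective ℂ h3 ((one_smul _ _).trans h1)).symm

/-- An operator intertwined by `U` is a conjugate by `U`. -/
theorem phaseWeyl_eq_conj (hω : IsPrimitiveRoot ω p) (c : ZMod p) {v : N ⊕ N → ZMod p}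
    (U : UnitaryOp p N) {A : Op p N} {a : ℂ}
    (h : weyl ω v * (U : Op p N) = a • ((U : Op p N) * A)) :
    (phaseWeyl hω c v : Op p N) =
      (phase hω c * a) • ((U : Op p N) * A * (U : Op p N)ᴴ) := by
  have hU : (U : Op p N) * (U : Op p N)ᴴ = 1 := Matrix.mem_unitaryGroup_iff.1 U.2
  rw [mul_smul, ← smul_mul_assoc a, ← h, mul_assoc, hU, mul_one]
  rfl

end Main

end QSS

theorem lemma3 {p : ℕ} [Fact p.Prime] (ω : ℂ) (hω : IsPrimitiveRoot ω p) {n k m : ℕ} {d : ℕ∞}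
    (S : Subgroup (QSS.UnitaryOp p (Fin n))) (hS : QSS.IsStabilizer ω S)
    (Q : Submodule ℂ (QSS.Basis p (Fin n) → ℂ)) (hQ : QSS.IsStabilizerCode S Q)
    (hk : Module.finrank ℂ Q = p ^ k) (hd : QSS.minDistance ω S = d)
    (J : Finset (Fin n)) (hJ : J.Nonempty)
    (H : Matrix (Fin m) (Fin n ⊕ Fin n) (ZMod p)) (hH : QSS.IsCheckMatrix ω S H)
    (hHJ : QSS.SatisfiesConditions H J) :
    ∃ (SJ : Subgroup (QSS.UnitaryOp p {j // j ∉ J})) (UJ : QSS.UnitaryOp p {j // j ∉ J})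
      (ℓ : ℕ) (e : {j // j ∈ J} ⊕ (Fin ℓ ⊕ Fin k) ≃ {j // j ∉ J}),
      QSS.IsEAQECC ω J SJ S UJ e d ∧
      LinearMap.range (QSS.encoder J UJ e).mulVecLin = Q ∧
      (∀ T : Finset (Fin n),
        QSS.EncoderCorrects (QSS.encoder J UJ e) T ↔ QSS.CodeCorrects Q T) ∧
      QSS.AdvanceShareable (QSS.encoder J UJ e) J := by
  open QSS in
  classical
  obtain ⟨ρ, σ, hρF, hσF, hρ, hσ⟩ := hHJ.exists_rows
  obtain ⟨ℓ, τ, hτ, hli, hspan⟩ := exists_adapted_basis J _ hρF hσF hρ hσ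
  set γ : {j // j ∈ J} ⊕ ({j // j ∈ J} ⊕ Fin ℓ) → Fin n ⊕ Fin n → ZMod p :=
    Sum.elim ρ (Sum.elim σ τ) with hγ
  have hF : (Submodule.span (ZMod p) (Set.range γ) : Set (Fin n ⊕ Fin n → ZMod p)) =
      symplecticImage ω S := by rw [hspan]; exact hH
  obtain ⟨lam, hlam⟩ := hQ.exists_eigenvalues hω hS
  rw [← hF] at hlam
  obtain ⟨w, hwQ, hw⟩ := exists_eigenFrame hω J hli hρ hσ hτ (fun w hw => (hlam w).1 hw) hk
  have hγF : ∀ g, γ g ∈ Submodule.span (ZMod p) (Set.range γ) :=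
    fun g => Submodule.subset_span ⟨g, rfl⟩
  -- With `c = |J|`, the dimension formula reads `p^k * p^(2c + ℓ) = p^n`, so `c + ℓ + k = n - c`.
  have hcard : Fintype.card ({j // j ∈ J} ⊕ (Fin ℓ ⊕ Fin k)) = Fintype.card {j // j ∉ J} := by
    have h1 := finrank_eigenspace_mul hω _ lam hQ.1 hlam
    rw [hk, finrank_span_eq_card hli, ← pow_add] at h1
    have h2 := Nat.pow_right_injective (Fact.out : p.Prime).two_le h1
    have h3 := Fintype.card_subtype_compl fun j => j ∈ J
    have h4 := Fintype.card_subtype_le fun j => j ∈ J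
    simp only [Fintype.card_sum, Fintype.card_fin] at h2 h3 h4 ⊢
    omega
  let e : {j // j ∈ J} ⊕ (Fin ℓ ⊕ Fin k) ≃ {j // j ∉ J} := Fintype.equivOfCardEq hcard
  let U : UnitaryOp p {j // j ∉ J} := ⟨sliceMatrix e w, hw.sliceMatrix_mem_unitaryGroup e⟩
  have henc : ∀ x s, encoder J U e x s = w 0 s x := hw.encoder_sliceMatrix e
  have hiso : (encoder J U e)ᴴ * encoder J U e = 1 := by
    ext s s'
    rw [Matrix.one_apply, ← hw.orthonormal 0 s s']
    change ∑ x, star (encoder J U e x s) * encoder J U e x s' = _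
    simp only [henc]
    rfl
  have hrange : LinearMap.range (encoder J U e).mulVecLin = Q := by
    apply Submodule.eq_of_le_of_finrank_eq
    · rintro _ ⟨ψ, rfl⟩
      have : (encoder J U e).mulVecLin ψ = ∑ s, ψ s • w 0 s := by
        funext x
        simp [Matrix.mulVec, dotProduct, henc, mul_comm]
      rw [this]
      exact Q.sum_mem fun s _ => Q.smul_mem _ (hwQ s)
    · rw [hk, LinearMap.finrank_range_of_inj, Module.finrank_fintype_fun_eq_card,
        Fintype.card_fun, ZMod.card, Fintype.card_fin]
      intro ψ ψ' h
      have h1 := congrArg (fun v => (encoder J U e)ᴴ *ᵥ v) h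
      simp only [Matrix.mulVecLin_apply, Matrix.mulVec_mulVec] at h1
      have h2 : ∀ φ, ((encoder J U e)ᴴ * encoder J U e) *ᵥ φ = φ := fun φ => by
        rw [hiso, Matrix.one_mulVec]
      exact (h2 ψ).symm.trans (h1.trans (h2 ψ'))
  have hM : ∀ g, ∃ (c : ZMod p) (M : UnitaryOp p (Fin n)), M ∈ S ∧
      (M : Op p (Fin n)) = phase hω c • weyl ω (γ g) := by
    intro g
    have hg : γ g ∈ symplecticImage ω S := by rw [← hF]; exact hγF g
    obtain ⟨M, hM, i, h⟩ := hg
    exact ⟨i, M, hM, by rw [h, phase_natCast]; rfl⟩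
  choose c M hMS hMγ using hM
  -- The phase `c g` of `M g` is carried over, so that each extended generator equals `M g` exactly,
  -- not just up to a scalar.
  let B : {j // j ∈ J} ⊕ ({j // j ∈ J} ⊕ Fin ℓ) → UnitaryOp p {j // j ∉ J} :=
    fun g => phaseWeyl hω (c g) (outside J (γ g))
  have hsymp : ∀ g g', symp (outside J (γ g)) (outside J (γ g')) =
      -symp (inside J (γ g)) (inside J (γ g')) := by
    intro g g'
    obtain ⟨w₀, hw₀Q, hw₀⟩ := Q.ne_bot_iff.1 hQ.1
    rw [eq_neg_iff_add_eq_zero, ← symp_split]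
    exact symp_eq_zero_of_eigenvector hω hw₀ ((hlam w₀).1 hw₀Q _ (hγF g))
      ((hlam w₀).1 hw₀Q _ (hγF g'))
  have hins_x : ∀ i, inside J (γ (Sum.inl i)) =
    Sum.elim (Pi.single i 1) (0 : {j // j ∈ J} → ZMod p) := hρ
  have hins_z : ∀ i, inside J (γ (Sum.inr (Sum.inl i))) =
    Sum.elim (0 : {j // j ∈ J} → ZMod p) (Pi.single i (-1)) := hσ
  have hins_a : ∀ a, inside J (γ (Sum.inr (Sum.inr a))) = 0 := hτ
  have hxx : ∀ i j, symp (outside J (γ (Sum.inl i))) (outside J (γ (Sum.inl j))) = 0 := by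
    intro i j
    rw [hsymp, hins_x, hins_x]
    simp [symp]
  have hzz : ∀ i j, symp (outside J (γ (Sum.inr i))) (outside J (γ (Sum.inr j))) = 0 := by
    rintro (i | i) (j | j) <;> rw [hsymp] <;> simp [hins_z, hins_a, symp]
  have hxz : ∀ i j, symp (outside J (γ (Sum.inl i))) (outside J (γ (Sum.inr j))) =
      if j = Sum.inl i then -1 else 0 := by
    rintro i (j | j) <;> rw [hsymp]
    · by_cases h : j = i
      · simp [hins_x, hins_z, symp, Pi.single_apply, h]
      · simp [hins_x, hins_z, symp, Pi.single_apply, h, Ne.symm h]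
    · simp [hins_a, symp]
  have hext_x : ∀ i, joint J (B (Sum.inl i) : Op p _) (single i (shift p ^ 1)) =
      (M (Sum.inl i) : Op p (Fin n)) := by
    intro i
    rw [hMγ, single_shift ω, ← hins_x, coe_phaseWeyl, joint_smul_left, joint_weyl hω]
  have hext_z : ∀ i, joint J (B (Sum.inr (Sum.inl i)) : Op p _) (single i (clock p ω)⁻¹) =
      (M (Sum.inr (Sum.inl i)) : Op p (Fin n)) := by
    intro i
    rw [hMγ, single_clock_inv hω, ← hins_z, coe_phaseWeyl, joint_smul_left, joint_weyl hω]
  have hext_a : ∀ a, joint J (B (Sum.inr (Sum.inr a)) : Op p _) 1 =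
      (M (Sum.inr (Sum.inr a)) : Op p (Fin n)) := by
    intro a
    rw [hMγ, ← weyl_zero hω, ← hins_a a, coe_phaseWeyl, joint_smul_left, joint_weyl hω]
  have hext : extendedGenerators ω J (fun j => B (Sum.inr j)) (fun i => B (Sum.inl i))
      (fun _ => 1) = Set.range M := by
    ext A
    constructor
    · rintro (⟨i, h⟩ | ⟨i, h⟩ | ⟨a, h⟩)
      exacts [⟨Sum.inl i, Subtype.ext (h.trans (hext_x i)).symm⟩,
        ⟨Sum.inr (Sum.inl i), Subtype.ext (h.trans (hext_z i)).symm⟩,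
        ⟨Sum.inr (Sum.inr a), Subtype.ext (h.trans (hext_a a)).symm⟩]
    · rintro ⟨i | i | a, rfl⟩
      exacts [Or.inl ⟨i, (hext_x i).symm⟩, Or.inr (Or.inl ⟨i, (hext_z i).symm⟩),
        Or.inr (Or.inr ⟨a, (hext_a a).symm⟩)]
  have hMS' : Set.range M ⊆ S := by
    rintro _ ⟨g, rfl⟩
    exact hMS g
  have hne : ∀ i, B (Sum.inl i) * B (Sum.inr (Sum.inl i)) ≠
      B (Sum.inr (Sum.inl i)) * B (Sum.inl i) := fun i =>
    phaseWeyl_ne hω _ _ (by rw [hxz, if_pos rfl]; exact neg_ne_zero.2 one_ne_zero)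
  refine ⟨Subgroup.closure (Set.range (fun j => B (Sum.inr j)) ∪ Set.range fun i => B (Sum.inl i)),
    U, ℓ, e, ⟨?_, ?_, hS, ?_, ?_, hd⟩, hrange, ?_, advanceShareable_encoder J U e⟩
  · rw [← coe_errorSubgroup hω, SetLike.coe_subset_coe, Subgroup.closure_le]
    rintro _ (⟨j, rfl⟩ | ⟨i, rfl⟩)
    · exact (mem_errorGroup_iff hω).2 ⟨_, _, rfl⟩
    · exact (mem_errorGroup_iff hω).2 ⟨_, _, rfl⟩
  · obtain ⟨i, hi⟩ := hJ
    intro h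
    exact hne ⟨i, hi⟩ (h _ (Subgroup.subset_closure (Or.inr ⟨_, rfl⟩)) _
      (Subgroup.subset_closure (Or.inl ⟨_, rfl⟩)))
  -- Every `μ i` is `1` because `ρ i` restricts on `J` to the first power of `X` on qudit `i`.
  · refine ⟨fun j => B (Sum.inr j), fun i => B (Sum.inl i), fun _ => 1, rfl,
      fun i j => phaseWeyl_commute hω _ _ (hxx i j), fun i j => phaseWeyl_commute hω _ _ (hzz i j),
      fun i j hij => phaseWeyl_commute hω _ _ (by rw [hxz, if_neg hij]), hne, fun i => ?_,
      fun i => ⟨_, phaseWeyl_eq_conj hω _ U (hw.weyl_mul_sliceMatrix_x e i)⟩,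
      fun j => ⟨_, phaseWeyl_eq_conj hω _ U (hw.weyl_mul_sliceMatrix_z e j)⟩, ?_, ?_⟩
    · have h := phaseWeyl_mul_comm hω (c (Sum.inl i)) (c (Sum.inr (Sum.inl i)))
        (outside J (γ (Sum.inl i))) (outside J (γ (Sum.inr (Sum.inl i))))
      have h1 : phase hω 1 = ω ^ 1 := by simpa using phase_natCast hω 1
      rw [hxz, if_pos rfl, AddChar.map_neg_eq_inv, h1] at h
      exact h
    · rw [hext]
      exact hMS'
    · rw [hext]
      exact eq_closure_union_scalars hω hS.1 hMS' (fun g => ⟨M g, ⟨g, rfl⟩, _, hMγ g⟩) hF.ge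
  · rw [hrange]
    exact hQ
  · intro T
    rw [encoderCorrects_iff_codeCorrects hiso, hrange]
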